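/- Let $\{v(0,k)\}_{k\in\mathbb Z}$ be i.i.d. Poisson$(1)$ random variables and, independently of them, let $S^{(k,i)}$, $k\in\mathbb Z$, $i\ge 1$, be independent two-sided simple symmetric random walks on $\mathbb Z$ indexed by time $t\in\mathbb Z$, with $S^{(k,i)}(0)=k$. For $(t,y)\in\mathbb Z^2$ put $$e^{\pm}(t,y)=\#\{(k,i): 1\le i\le v(0,k),\ S^{(k,i)}(t)=y,\ S^{(k,i)}(t+1)=y\pm1\},\qquad v(t,y)=e^+(t,y)+e^-(t,y).$$ Let $\mathbb P$ be the law of the environment $\omega=\{(e^+(t,y),e^-(t,y)):(t,y)\in\mathbb Z^2\}$ on $(\mathbb N_0^2)^{\mathbb Z^2}$ with the product $\sigma$-field, with expectation $\mathbb E$, and let $\tilde{\mathbb P}(A)=\mathbb E(v(0,0)\mathbf 1_A)$, with expectation $\tilde{\mathbb E}$. Given $\omega$, let $(X_n)_{n\ge0}$ be, under $\mathbb P^\omega_{(0,0)}$ (with expectation $\mathbb E^\omega_{(0,0)}$), the Markov chain on $\mathbb Z^2$ with $X_0=(0,0)$ that moves from $(t,y)$ to $(t+1,y+1)$ with probability $e^+(t,y)/v(t,y)$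 and to $(t+1,y-1)$ with probability $e^-(t,y)/v(t,y)$. (Sites with $v(t,y)=0$ are $\tilde{\mathbb P}$-a.s. never visited; from such a site the chain moves, by convention, to $(t+1,y)$.) Then, for $\tilde{\mathbb P}$-almost every $\omega$, $X_n$ is integrable under $\mathbb P^\omega_{(0,0)}$ for all $n$; for every $n$ the random variable $\left|\mathbb E^\omega_{(0,0)}(X_n)-(n,0)\right|^2$ is $\tilde{\mathbb P}$-integrable; and $$\tilde{\mathbb E}\left|\mathbb E^\omega_{(0,0)}(X_n)-(n,0)\right|^2=O\!\left(\sqrt n\,(\log n)^3\right)\qquad\text{as } n\to\infty,$$ where $|\cdot|$ is the Euclidean norm on $\mathbb R^2$. -/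

import Mathlib

open MeasureTheory ProbabilityTheory Filter Asymptotics
open scoped ENNReal

noncomputable section

namespace MassSplitting

/-! ### Environments -/

/-- An environment assigns to every space-time point `(t, y)` (time first) the numbers
`(e⁺(t, y), e⁻(t, y))` of up-crossings and down-crossings. It carries the product σ-algebra. -/
abbrev Env : Type := ℤ × ℤ → ℕ × ℕ

/-- `e⁺(t, y)`. -/
def ePlus (ω : Env) (z : ℤ × ℤ) : ℕ := (ω z).1

/-- `e⁻(t, y)`. -/
def eMinus (ω : Env) (z : ℤ × ℤ) : ℕ := (ω z).2

/-- `v(t, y) = e⁺(t, y) + e⁻(t, y)`. -/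
def occ (ω : Env) (z : ℤ × ℤ) : ℕ := ePlus ω z + eMinus ω z

/-! ### The particle system and the law of the environment -/

/-- The increment of a simple random walk encoded by a coin toss. -/
def coinStep (b : Bool) : ℤ := if b then 1 else -1

/-- The two-sided walk with `S(0) = k` and `S(t + 1) - S(t) = coinStep (ξ t)` for all `t ∈ ℤ`. -/
def walk (k : ℤ) (ξ : ℤ → Bool) (t : ℤ) : ℤ :=
  k + ∑ s ∈ Finset.Ico 0 t, coinStep (ξ s) - ∑ s ∈ Finset.Ico t 0, coinStep (ξ s)

/-- A configuration: the initial numbers of particles `v(0, k)`, and the coin tosses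
driving the walk of the `i`-th particle started at `k`; the particles present at `k` are
those with `i < v(0, k)`. -/
abbrev Config : Type := (ℤ → ℕ) × (ℤ × ℕ → ℤ → Bool)

/-- A fair coin. -/
def fairCoin : Measure Bool := (PMF.uniformOfFintype Bool).toMeasure

instance : IsProbabilityMeasure fairCoin := by
  unfold fairCoin; infer_instance

/-- I.i.d. Poisson(1) initial occupation numbers and, independently of them, i.i.d. two-sided
simple random walks. -/
def configLaw : Measure Config :=
  (Measure.infinitePi fun _ : ℤ => poissonMeasure 1).prod
    (Measure.infinitePi fun _ : ℤ × ℕ => Measure.infinitePi fun _ : ℤ => fairCoin)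

/-- The particles that are at `y` at time `t` and at `y'` at time `t + 1`. -/
def crossers (c : Config) (t y y' : ℤ) : Set (ℤ × ℕ) :=
  {p | p.2 < c.1 p.1 ∧ walk p.1 (c.2 p) t = y ∧ walk p.1 (c.2 p) (t + 1) = y'}

/-- The environment generated by a particle configuration. -/
def envOf (c : Config) : Env := fun z =>
  ((crossers c z.1 z.2 (z.2 + 1)).ncard, (crossers c z.1 z.2 (z.2 - 1)).ncard)

/-- The law `ℙ` of the environment. -/
def envLaw : Measure Env := configLaw.map envOf

/-- The size-biased law `ℙ̃(A) = 𝔼(v(0,0) 1_A)`. -/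
def tiltedLaw : Measure Env := envLaw.withDensity fun ω => (occ ω (0, 0) : ℝ≥0∞)

/-! The next facts show that `envOf` is measurable, so that `envLaw` is a genuine image law, and
that only finitely many particles are counted by `envOf`. -/

lemma abs_sum_coinStep_le (ξ : ℤ → Bool) (s : Finset ℤ) :
    |∑ i ∈ s, coinStep (ξ i)| ≤ s.card := by
  refine (Finset.abs_sum_le_sum_abs _ _).trans ?_
  have : ∀ i ∈ s, |coinStep (ξ i)| = 1 := fun i _ => by cases h : ξ i <;> simp [coinStep]
  rw [Finset.sum_congr rfl this]; simp

lemma abs_walk_sub_le (k : ℤ) (ξ : ℤ → Bool) (t : ℤ) : |walk k ξ t - k| ≤ |t| := by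
  have h1 := abs_sum_coinStep_le ξ (Finset.Ico 0 t)
  have h2 := abs_sum_coinStep_le ξ (Finset.Ico t 0)
  rw [Int.card_Ico] at h1 h2
  unfold walk
  rw [abs_le] at *
  rcases abs_cases t with h | h <;> constructor <;> omega

lemma walk_mem_Icc {k y t : ℤ} {ξ : ℤ → Bool} (h : walk k ξ t = y) :
    k ∈ Finset.Icc (y - |t|) (y + |t|) := by
  have := abs_walk_sub_le k ξ t
  rw [abs_le] at this
  rw [Finset.mem_Icc]
  omega

lemma finite_crossers (c : Config) (t y y' : ℤ) : (crossers c t y y').Finite := by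
  refine (((Finset.Icc (y - |t|) (y + |t|)).sigma
    fun k => Finset.range (c.1 k)).finite_toSet.image fun p => (p.1, p.2)).subset ?_
  rintro ⟨k, i⟩ ⟨h1, h2, -⟩
  exact ⟨⟨k, i⟩, by simpa using ⟨by simpa using walk_mem_Icc h2, h1⟩, rfl⟩

lemma measurable_walk (p : ℤ × ℕ) (t : ℤ) : Measurable fun c : Config => walk p.1 (c.2 p) t := by
  have h : ∀ s : ℤ, Measurable fun c : Config => coinStep (c.2 p s) := fun s =>
    (measurable_of_countable coinStep).comp
      ((measurable_pi_apply s).comp ((measurable_pi_apply p).comp measurable_snd))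
  unfold walk
  exact (measurable_const.add (Finset.measurable_sum _ fun s _ => h s)).sub
    (Finset.measurable_sum _ fun s _ => h s)

lemma measurableSet_mem_crossers (p : ℤ × ℕ) (t y y' : ℤ) :
    MeasurableSet {c : Config | p ∈ crossers c t y y'} := by
  have h0 : Measurable fun c : Config => c.1 p.1 := (measurable_pi_apply p.1).comp measurable_fst
  exact (h0 (MeasurableSet.of_discrete (s := {m | p.2 < m}))).inter
    ((measurable_walk p t (MeasurableSet.singleton y)).inter
      (measurable_walk p (t + 1) (MeasurableSet.singleton y')))

lemma measurable_ncard_crossers (t y y' : ℤ) :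
    Measurable fun c : Config => (crossers c t y y').ncard := by
  refine measurable_to_countable' fun m => ?_
  have : (fun c : Config => (crossers c t y y').ncard) ⁻¹' {m} =
      ⋃ F ∈ {F : Finset (ℤ × ℕ) | F.card = m}, {c : Config | crossers c t y y' = ↑F} := by
    ext c
    simp only [Set.mem_preimage, Set.mem_singleton_iff, Set.mem_iUnion, Set.mem_ofPred_eq,
      exists_prop]
    constructor
    · intro h
      exact ⟨(finite_crossers c t y y').toFinset,
        by rw [← h, Set.ncard_eq_toFinset_card _ (finite_crossers c t y y')], by simp⟩
    · rintro ⟨F, rfl, h⟩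
      rw [h, Set.ncard_coe_finset]
  rw [this]
  refine MeasurableSet.biUnion (Set.to_countable _) fun F _ => ?_
  have : {c : Config | crossers c t y y' = ↑F} =
      ⋂ p : ℤ × ℕ, {c : Config | p ∈ crossers c t y y' ↔ p ∈ F} := by
    ext c; simp [Set.ext_iff]
  rw [this]
  refine MeasurableSet.iInter fun p => ?_
  by_cases hp : p ∈ F
  · simpa [hp] using measurableSet_mem_crossers p t y y'
  · simp only [hp, iff_false]
    exact (measurableSet_mem_crossers p t y y').compl

lemma measurable_envOf : Measurable envOf :=
  measurable_pi_lambda _ fun _ =>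
    (measurable_ncard_crossers _ _ _).prodMk (measurable_ncard_crossers _ _ _)

/-! ### The random walk in a fixed environment -/

/-- One step of the walk from `z = (t, y)`: to `(t + 1, y + 1)` with probability `e⁺(z) / v(z)`
and to `(t + 1, y - 1)` with probability `e⁻(z) / v(z)`. From an empty site (never visited under
`tiltedLaw`) the walk keeps its spatial position by convention. -/
def stepLaw (ω : Env) (z : ℤ × ℤ) : Measure (ℤ × ℤ) :=
  if occ ω z = 0 then Measure.dirac (z.1 + 1, z.2)
  else ((ePlus ω z : ℝ≥0∞) / occ ω z) • Measure.dirac (z.1 + 1, z.2 + 1) +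
    ((eMinus ω z : ℝ≥0∞) / occ ω z) • Measure.dirac (z.1 + 1, z.2 - 1)

instance (ω : Env) (z : ℤ × ℤ) : IsProbabilityMeasure (stepLaw ω z) := by
  unfold stepLaw
  split_ifs with h
  · infer_instance
  · constructor
    have h' : (occ ω z : ℝ≥0∞) ≠ 0 := by exact_mod_cast h
    simp only [Measure.coe_add, Measure.coe_smul, Pi.add_apply, Pi.smul_apply, measure_univ,
      smul_eq_mul, mul_one]
    rw [← ENNReal.add_div, ← Nat.cast_add]
    exact ENNReal.div_self h' (ENNReal.natCast_ne_top _)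

/-- The transition kernel of the walk in the environment `ω`. -/
def stepKernel (ω : Env) : Kernel (ℤ × ℤ) (ℤ × ℤ) where
  toFun := stepLaw ω
  measurable' := measurable_of_countable _

instance (ω : Env) : IsMarkovKernel (stepKernel ω) :=
  ⟨fun z => inferInstanceAs (IsProbabilityMeasure (stepLaw ω z))⟩

/-- The transition kernel at the `n`-th step, as a function of the path up to `n`: by the Markov
property it looks at the current position only. -/
def pathKernel (ω : Env) (n : ℕ) : Kernel (Finset.Iic n → ℤ × ℤ) (ℤ × ℤ) :=
  (stepKernel ω).comap (fun x => x ⟨n, Finset.mem_Iic.2 le_rfl⟩) (measurable_pi_apply _)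

instance (ω : Env) (n : ℕ) : IsMarkovKernel (pathKernel ω n) := by
  unfold pathKernel; infer_instance

/-- The quenched law `ℙ^ω_z`: the law on path space of the Markov chain `(X_n)` with `X_0 = z` and
transition kernel `stepKernel ω`. -/
def quenchedLaw (ω : Env) (z : ℤ × ℤ) : Measure (ℕ → ℤ × ℤ) :=
  Kernel.trajMeasure (X := fun _ => ℤ × ℤ) (Measure.dirac z) (pathKernel ω)

/-- A space-time lattice point as a vector of the Euclidean plane. -/
def toPlane (z : ℤ × ℤ) : EuclideanSpace ℝ (Fin 2) := !₂[(z.1 : ℝ), (z.2 : ℝ)]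

/-- The quenched mean `𝔼^ω_{(0,0)}(X_n)`. -/
def quenchedMean (ω : Env) (n : ℕ) : EuclideanSpace ℝ (Fin 2) :=
  ∫ X, toPlane (X n) ∂(quenchedLaw ω (0, 0))

end MassSplitting

end

/-!
The quenched mean is a martingale whose increments have an explicit conditional variance, and this
variance is the energy of an averaging process that dissipates it.

**Reduction to an energy.** The time coordinate of the walk is deterministic, so only the space
coordinate `quenchedDrift ω n` of the quenched mean matters. Write `share ω k y` for the quenched
probability of being at `y` at time `k`, divided by the number of particles there. A particle
passes its share on to the site it jumps to, and there all particles pool their shares and divide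
them equally. The tosses at time `k` are independent of the configuration up to time `k`, so
`quenchedDrift` is a martingale; the conditional variance of its increment is the sum of the
squared shares of all particles, `energy ω k` (`integral_quenchedDrift_succ_sq`). Hence the
variance of the quenched mean under the size-biased law is `∑ k < n, meanEnergy k`.

**Dissipation.** Pooling is an orthogonal projection, so the energy decreases by the squared
displacement of the vector of shares (`energy_succ`), and whenever two particles meet within the
next `s` steps their shares must have come together (`sq_shareOf_sub_le`). At a fixed time the
particles form a Poisson field of intensity one (`configLaw_empty_le`), so with `N` of order `log
n` every stretch of `N` sites of one parity holds a particle, up to an event of polynomially small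
probability (`configLaw_compl_wellSpread_le`). In that case a chain of particles with gaps of
order `N` leads from the site of largest share to a site of at most half that share, and a
discrete Nash inequality (`exists_chain`) bounds the Dirichlet sum along the chain from below by a
multiple of the cube of the energy. Two consecutive particles meet after exactly `s = 8 N ^ 2`
steps with probability at least `1 / (4 s)`, by a bound on binomial coefficients
(`coinLaw_meet_ge`). This gives `meanEnergy (k + s) ≤ meanEnergy k - meanEnergy k ^ 3 / (128 s ^
2)`, up to a negligible error (`meanEnergy_add_le`), hence `meanEnergy k = O(s ^ (3 / 2) / √k) =
O((log n) ^ 3 / √k)`, and summation over `k < n` yields the claim.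
-/

noncomputable section

namespace MassSplitting

/-! ### The quenched mean as a finite sum -/

/-- The quenched probability `ℙ^ω_{(0,0)}(X_k = (k, y))`, given by its forward recursion. The last
term is the convention that the walk keeps its position when it leaves an empty site. -/
def massAt (ω : Env) : ℕ → ℤ → ℝ
  | 0, y => if y = 0 then 1 else 0
  | k + 1, y =>
    massAt ω k (y - 1) * (ePlus ω (k, y - 1) / occ ω (k, y - 1)) +
      massAt ω k (y + 1) * (eMinus ω (k, y + 1) / occ ω (k, y + 1)) +
      if occ ω (k, y) = 0 then massAt ω k y else 0

lemma massAt_nonneg (ω : Env) (k : ℕ) (y : ℤ) : 0 ≤ massAt ω k y := by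
  induction k generalizing y with
  | zero => simp only [massAt]; split_ifs <;> simp
  | succ k ih =>
    have h1 := ih (y - 1)
    have h2 := ih (y + 1)
    have h3 := ih y
    simp only [massAt]
    split_ifs <;> positivity

lemma massAt_eq_zero (ω : Env) {k : ℕ} {y : ℤ} (h : (k : ℤ) < |y|) : massAt ω k y = 0 := by
  induction k generalizing y with
  | zero =>
    have : y ≠ 0 := by rintro rfl; simp at h
    simp [massAt, this]
  | succ k ih =>
    push_cast at h
    have h1 : massAt ω k (y - 1) = 0 := ih (by rw [lt_abs] at *; omega)
    have h2 : massAt ω k (y + 1) = 0 := ih (by rw [lt_abs] at *; omega)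
    have h3 : massAt ω k y = 0 := ih (by omega)
    simp [massAt, h1, h2, h3]

/-- The law of the position of the quenched walk at time `n`. -/
def stepMarginal (ω : Env) (n : ℕ) : Measure (ℤ × ℤ) :=
  (quenchedLaw ω (0, 0)).map fun X => X n

instance (ω : Env) (z : ℤ × ℤ) : IsProbabilityMeasure (quenchedLaw ω z) := by
  unfold quenchedLaw; infer_instance

instance (ω : Env) (n : ℕ) : IsProbabilityMeasure (stepMarginal ω n) :=
  Measure.isProbabilityMeasure_map (measurable_pi_apply n).aemeasurable

lemma stepMarginal_zero (ω : Env) : stepMarginal ω 0 = Measure.dirac (0, 0) := by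
  have h0 : (quenchedLaw ω (0, 0)).map (Preorder.frestrictLe 0) =
      (Measure.dirac ((0 : ℤ), (0 : ℤ))).map
        (MeasurableEquiv.piUnique (fun _ : Finset.Iic 0 => ℤ × ℤ)).symm := by
    rw [quenchedLaw, Kernel.trajMeasure, Measure.map_comp _ _ (by fun_prop),
      Kernel.traj_map_frestrictLe, Kernel.partialTraj_self, Measure.id_comp]
  have h1 : stepMarginal ω 0 = ((quenchedLaw ω (0, 0)).map (Preorder.frestrictLe 0)).map
      (fun x => x ⟨0, Finset.mem_Iic.2 le_rfl⟩) := by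
    rw [Measure.map_map (by fun_prop) (by fun_prop)]; rfl
  rw [h1, h0, Measure.map_map (by fun_prop) (by fun_prop)]
  exact Measure.map_dirac' (by fun_prop) _

lemma stepMarginal_succ (ω : Env) (n : ℕ) :
    stepMarginal ω (n + 1) = (stepMarginal ω n).bind (stepKernel ω) := by
  have h := Kernel.map_frestrictLe_trajMeasure_compProd_eq_map_trajMeasure
    (X := fun _ => ℤ × ℤ) (μ₀ := Measure.dirac ((0 : ℤ), (0 : ℤ))) (κ := pathKernel ω) (a := n)
  have h1 : stepMarginal ω (n + 1) =
      ((quenchedLaw ω (0, 0)).map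
        (fun x : ℕ → ℤ × ℤ => (Preorder.frestrictLe n x, x (n + 1)))).snd := by
    rw [Measure.snd, Measure.map_map (by fun_prop) (by fun_prop)]; rfl
  rw [h1, quenchedLaw, ← h, Measure.snd_compProd]
  ext s hs
  rw [Measure.bind_apply hs (Kernel.aemeasurable _), Measure.bind_apply hs (Kernel.aemeasurable _),
    lintegral_map (Kernel.measurable_coe _ hs) (by fun_prop), stepMarginal,
    lintegral_map (Kernel.measurable_coe _ hs) (by fun_prop)]
  rfl

lemma lintegral_stepLaw (ω : Env) (z : ℤ × ℤ) (g : ℤ × ℤ → ℝ≥0∞) :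
    ∫⁻ x, g x ∂stepLaw ω z =
      ENNReal.ofReal (ePlus ω z / occ ω z) * g (z.1 + 1, z.2 + 1) +
        ENNReal.ofReal (eMinus ω z / occ ω z) * g (z.1 + 1, z.2 - 1) +
        if occ ω z = 0 then g (z.1 + 1, z.2) else 0 := by
  unfold stepLaw
  split_ifs with h
  · simp [h]
  · have ho : (0 : ℝ) < occ ω z := by exact_mod_cast Nat.pos_of_ne_zero h
    simp [ENNReal.ofReal_div_of_pos ho]

lemma lintegral_stepMarginal (ω : Env) (n : ℕ) (g : ℤ × ℤ → ℝ≥0∞) :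
    ∫⁻ x, g x ∂stepMarginal ω n = ∑' y : ℤ, ENNReal.ofReal (massAt ω n y) * g (n, y) := by
  induction n generalizing g with
  | zero =>
    rw [stepMarginal_zero, lintegral_dirac, tsum_eq_single 0]
    · simp [massAt]
    · intro y hy; simp [massAt, hy]
  | succ n ih =>
    rw [stepMarginal_succ, Measure.lintegral_bind (Kernel.aemeasurable _) (by fun_prop)]
    have : ∀ z, ∫⁻ x, g x ∂(stepKernel ω z) = _ := fun z => lintegral_stepLaw ω z g
    simp only [this]
    rw [ih]
    simp only [mul_add]
    rw [ENNReal.tsum_add, ENNReal.tsum_add]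
    have e1 := (Equiv.addRight (-1 : ℤ)).tsum_eq fun y : ℤ => ENNReal.ofReal (massAt ω n y) *
        (ENNReal.ofReal (ePlus ω (n, y) / occ ω (n, y)) * g ((n : ℤ) + 1, y + 1))
    have e2 := (Equiv.addRight (1 : ℤ)).tsum_eq fun y : ℤ => ENNReal.ofReal (massAt ω n y) *
        (ENNReal.ofReal (eMinus ω (n, y) / occ ω (n, y)) * g ((n : ℤ) + 1, y - 1))
    rw [← e1, ← e2, ← ENNReal.tsum_add, ← ENNReal.tsum_add]
    refine tsum_congr fun y => ?_
    have p1 := massAt_nonneg ω n (y - 1)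
    have p2 := massAt_nonneg ω n (y + 1)
    have p3 := massAt_nonneg ω n y
    simp only [massAt, Equiv.coe_addRight, add_sub_cancel_right,
      Nat.cast_add, Nat.cast_one, ← sub_eq_add_neg]
    rw [ENNReal.ofReal_add (by positivity) (by split_ifs <;> positivity),
      ENNReal.ofReal_add (by positivity) (by positivity), ENNReal.ofReal_mul p1,
      ENNReal.ofReal_mul p2, add_mul, add_mul, mul_assoc, mul_assoc]
    split_ifs <;> simp

lemma stepMarginal_eq (ω : Env) (n : ℕ) :
    stepMarginal ω n = ∑ y ∈ Finset.Icc (-n : ℤ) n,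
      ENNReal.ofReal (massAt ω n y) • Measure.dirac ((n : ℤ), y) := by
  refine Measure.ext_of_lintegral _ fun g hg => ?_
  rw [lintegral_stepMarginal, lintegral_finsetSum_measure, tsum_eq_sum (s := Finset.Icc (-n : ℤ) n)]
  · simp
  · intro y hy
    rw [Finset.mem_Icc] at hy
    rw [massAt_eq_zero ω (by rw [lt_abs]; omega)]
    simp

lemma sum_massAt (ω : Env) (n : ℕ) : ∑ y ∈ Finset.Icc (-n : ℤ) n, massAt ω n y = 1 := by
  have h : stepMarginal ω n Set.univ = 1 := measure_univ
  rw [stepMarginal_eq] at h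
  simp only [Measure.coe_finsetSum, Finset.sum_apply, Measure.smul_apply, measure_univ,
    smul_eq_mul, mul_one] at h
  rw [← ENNReal.ofReal_sum_of_nonneg fun y _ => massAt_nonneg ω n y] at h
  simpa using h

/-- The second coordinate of the quenched mean of `X_n`. -/
def quenchedDrift (ω : Env) (n : ℕ) : ℝ := ∑ y ∈ Finset.Icc (-n : ℤ) n, massAt ω n y * y

lemma integrable_toPlane_stepMarginal (ω : Env) (n : ℕ) :
    Integrable toPlane (stepMarginal ω n) := by
  rw [stepMarginal_eq]
  refine integrable_finsetSum_measure.2 fun y _ => ?_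
  exact (integrable_dirac (by simp)).smul_measure ENNReal.ofReal_ne_top

lemma integrable_toPlane (ω : Env) (n : ℕ) :
    Integrable (fun X : ℕ → ℤ × ℤ => toPlane (X n)) (quenchedLaw ω (0, 0)) :=
  (integrable_toPlane_stepMarginal ω n).comp_measurable (by fun_prop)

lemma quenchedMean_eq (ω : Env) (n : ℕ) :
    quenchedMean ω n = ∑ y ∈ Finset.Icc (-n : ℤ) n, massAt ω n y • toPlane (n, y) := by
  have h : quenchedMean ω n = ∫ x, toPlane x ∂stepMarginal ω n :=
    (integral_map (measurable_pi_apply n).aemeasurable (by fun_prop)).symm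
  rw [h, stepMarginal_eq, integral_finsetSum_measure]
  · refine Finset.sum_congr rfl fun y _ => ?_
    rw [integral_smul_measure, integral_dirac, ENNReal.toReal_ofReal (massAt_nonneg ω n y)]
  · intro y _
    exact (integrable_dirac (by simp)).smul_measure ENNReal.ofReal_ne_top

/-- The time coordinate of the walk is deterministic, so only the space coordinate contributes. -/
lemma norm_quenchedMean_sub_sq (ω : Env) (n : ℕ) :
    ‖quenchedMean ω n - toPlane (n, 0)‖ ^ 2 = quenchedDrift ω n ^ 2 := by
  have h : quenchedMean ω n - toPlane (n, 0) = !₂[0, quenchedDrift ω n] := by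
    rw [quenchedMean_eq]
    ext i
    fin_cases i
    · simp [toPlane, ← Finset.sum_mul, sum_massAt]
    · simp [toPlane, quenchedDrift]
  rw [h, EuclideanSpace.norm_sq_eq]
  simp

/-! ### Coin tosses: resampling the future and elementary moments -/

/-- The law of the coin tosses driving all the walks. -/
def coinLaw : Measure (ℤ × ℕ → ℤ → Bool) :=
  Measure.infinitePi fun _ : ℤ × ℕ => Measure.infinitePi fun _ : ℤ => fairCoin

instance : IsProbabilityMeasure coinLaw := by unfold coinLaw; infer_instance

/-- The coin tosses of `ξ` before time `k`, followed by those of `ξ'` from time `k` on. -/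
def splice (k : ℤ) (ξ ξ' : ℤ × ℕ → ℤ → Bool) : ℤ × ℕ → ℤ → Bool :=
  fun p t => if t < k then ξ p t else ξ' p t

/-- The tosses as one family indexed by particle and time. -/
def flatCoinLaw : Measure ((ℤ × ℕ) × ℤ → Bool) := Measure.infinitePi fun _ => fairCoin

instance : IsProbabilityMeasure flatCoinLaw := by unfold flatCoinLaw; infer_instance

lemma measurePreserving_curry :
    MeasurePreserving (fun (x : (ℤ × ℕ) × ℤ → Bool) p t => x (p, t)) flatCoinLaw coinLaw :=
  ⟨by fun_prop, Measure.infinitePi_map_curry fun _ _ => fairCoin⟩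

lemma measurable_splice (k : ℤ) :
    Measurable fun x : (ℤ × ℕ → ℤ → Bool) × (ℤ × ℕ → ℤ → Bool) => splice k x.1 x.2 := by
  refine measurable_pi_lambda _ fun p => measurable_pi_lambda _ fun t => ?_
  unfold splice
  split_ifs <;> fun_prop

/-- The tosses from time `k` on are independent of the past, so they may be resampled. -/
lemma measurePreserving_splice (k : ℤ) :
    MeasurePreserving (fun x : (ℤ × ℕ → ℤ → Bool) × (ℤ × ℕ → ℤ → Bool) => splice k x.1 x.2)
      (coinLaw.prod coinLaw) coinLaw := by
  have hflat : MeasurePreserving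
      (fun (x : ((ℤ × ℕ) × ℤ → Bool) × ((ℤ × ℕ) × ℤ → Bool)) i =>
        if i.2 < k then x.1 i else x.2 i) (flatCoinLaw.prod flatCoinLaw) flatCoinLaw := by
    have hm : Measurable (fun (x : ((ℤ × ℕ) × ℤ → Bool) × ((ℤ × ℕ) × ℤ → Bool)) i =>
        if i.2 < k then x.1 i else x.2 i) := by
      refine measurable_pi_lambda _ fun i => ?_
      split_ifs <;> fun_prop
    refine ⟨hm, Measure.eq_infinitePi _ fun s t ht => ?_⟩
    classical
    rw [Measure.map_apply hm (MeasurableSet.pi s.countable_toSet fun i _ => ht i)]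
    have : (fun (x : ((ℤ × ℕ) × ℤ → Bool) × ((ℤ × ℕ) × ℤ → Bool)) i =>
        if i.2 < k then x.1 i else x.2 i) ⁻¹' (Set.pi s t) =
        (Set.pi (s.filter fun i => i.2 < k) t) ×ˢ (Set.pi (s.filter fun i => ¬ i.2 < k) t) := by
      ext x
      simp only [Set.mem_preimage, Set.mem_pi, Set.mem_prod, Finset.coe_filter,
        Set.mem_ofPred_eq, Finset.mem_coe]
      constructor
      · exact fun h => ⟨fun i hi => by simpa [hi.2] using h i hi.1,
          fun i hi => by simpa [hi.2] using h i hi.1⟩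
      · rintro ⟨h1, h2⟩ i hi
        split_ifs with h
        exacts [h1 i ⟨hi, h⟩, h2 i ⟨hi, h⟩]
    rw [this, Measure.prod_prod, flatCoinLaw, Measure.infinitePi_pi _ fun i _ => ht i,
      Measure.infinitePi_pi _ fun i _ => ht i, Finset.prod_filter_mul_prod_filter_not]
  have hc := measurePreserving_curry
  have h2 := hc.comp hflat
  refine ⟨measurable_splice k, ?_⟩
  rw [← (hc.prod hc).map_eq, Measure.map_map (measurable_splice k) (hc.prod hc).measurable]
  exact h2.map_eq

lemma integral_coinStep : ∫ b, (coinStep b : ℝ) ∂fairCoin = 0 := by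
  rw [fairCoin, integral_fintype (Integrable.of_finite)]
  simp [coinStep, Measure.real]

lemma measurable_coinStep_apply (a : ℤ × ℕ) (k : ℤ) :
    Measurable fun ξ : ℤ × ℕ → ℤ → Bool => (coinStep (ξ a k) : ℝ) :=
  (measurable_of_countable fun b : Bool => (coinStep b : ℝ)).comp (by fun_prop)

lemma abs_coinStep (b : Bool) : |(coinStep b : ℝ)| = 1 := by cases b <;> simp [coinStep]

lemma integral_coinStep_apply (a : ℤ × ℕ) (k : ℤ) :
    ∫ ξ, (coinStep (ξ a k) : ℝ) ∂coinLaw = 0 := by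
  have h : MeasurePreserving (fun ξ : ℤ × ℕ → ℤ → Bool => ξ a k) coinLaw fairCoin :=
    (measurePreserving_eval_infinitePi (fun _ : ℤ => fairCoin) k).comp
      (measurePreserving_eval_infinitePi
        (fun _ : ℤ × ℕ => Measure.infinitePi fun _ : ℤ => fairCoin) a)
  rw [← integral_coinStep, ← h.map_eq, integral_map h.measurable.aemeasurable
    (measurable_of_countable _).aestronglyMeasurable]

lemma integral_coinStep_mul {a b : ℤ × ℕ} (hab : a ≠ b) (k : ℤ) :
    ∫ ξ, (coinStep (ξ a k) : ℝ) * coinStep (ξ b k) ∂coinLaw = 0 := by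
  have hi : iIndepFun (fun (p : ℤ × ℕ) (ξ : ℤ × ℕ → ℤ → Bool) => (coinStep (ξ p k) : ℝ))
      coinLaw :=
    iIndepFun_infinitePi (X := fun _ (x : ℤ → Bool) => (coinStep (x k) : ℝ)) fun _ =>
      (measurable_of_countable fun b : Bool => (coinStep b : ℝ)).comp (measurable_pi_apply k)
  have := (hi.indepFun hab).integral_fun_mul_eq_mul_integral
    (measurable_coinStep_apply a k).aestronglyMeasurable
    (measurable_coinStep_apply b k).aestronglyMeasurable
  rw [this, integral_coinStep_apply, zero_mul]

/-- The tosses at one time are orthonormal and centred. -/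
lemma integral_sq_add_sum_coinStep (P : Finset (ℤ × ℕ)) (f : ℤ × ℕ → ℝ) (m : ℝ) (k : ℤ) :
    ∫ ξ, (m + ∑ a ∈ P, f a * coinStep (ξ a k)) ^ 2 ∂coinLaw = m ^ 2 + ∑ a ∈ P, f a ^ 2 := by
  classical
  have i1 : ∀ a, Integrable (fun ξ : ℤ × ℕ → ℤ → Bool => (coinStep (ξ a k) : ℝ)) coinLaw :=
    fun a => Integrable.of_bound (measurable_coinStep_apply a k).aestronglyMeasurable 1
      (ae_of_all _ fun ξ => (abs_coinStep _).le)
  have i2 : ∀ a b, Integrable (fun ξ : ℤ × ℕ → ℤ → Bool =>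
      (coinStep (ξ a k) : ℝ) * coinStep (ξ b k)) coinLaw := fun a b =>
    Integrable.of_bound ((measurable_coinStep_apply a k).mul
      (measurable_coinStep_apply b k)).aestronglyMeasurable 1
      (ae_of_all _ fun ξ => by rw [norm_mul, Real.norm_eq_abs, Real.norm_eq_abs, abs_coinStep,
        abs_coinStep, mul_one])
  have e : ∀ ξ : ℤ × ℕ → ℤ → Bool, (m + ∑ a ∈ P, f a * coinStep (ξ a k)) ^ 2 =
      m ^ 2 + (∑ a ∈ P, 2 * m * f a * coinStep (ξ a k)) +
        ∑ a ∈ P, ∑ b ∈ P, f a * f b * (coinStep (ξ a k) * coinStep (ξ b k)) := by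
    intro ξ
    have : (∑ a ∈ P, f a * (coinStep (ξ a k) : ℝ)) * (∑ b ∈ P, f b * coinStep (ξ b k)) =
        ∑ a ∈ P, ∑ b ∈ P, f a * f b * (coinStep (ξ a k) * coinStep (ξ b k)) := by
      rw [Finset.sum_mul_sum]
      exact Finset.sum_congr rfl fun a _ => Finset.sum_congr rfl fun b _ => by ring
    rw [← this]
    simp only [mul_assoc]
    rw [← Finset.mul_sum, ← Finset.mul_sum]
    ring
  simp only [e]
  rw [integral_add, integral_add, integral_finsetSum, integral_finsetSum]
  · have h1 : ∀ a ∈ P, ∫ ξ, 2 * m * f a * (coinStep (ξ a k) : ℝ) ∂coinLaw = 0 := fun a _ => by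
      rw [integral_const_mul, integral_coinStep_apply, mul_zero]
    have h2 : ∀ a ∈ P, ∫ ξ, ∑ b ∈ P, f a * f b * ((coinStep (ξ a k) : ℝ) * coinStep (ξ b k))
        ∂coinLaw = f a ^ 2 := fun a ha => by
      rw [integral_finsetSum _ fun b _ => (i2 a b).const_mul _, Finset.sum_eq_single a]
      · have : ∀ ξ : ℤ × ℕ → ℤ → Bool, (coinStep (ξ a k) : ℝ) * coinStep (ξ a k) = 1 := fun ξ => by
          rw [← abs_mul_abs_self, abs_coinStep, mul_one]
        simp only [this]
        simp [sq]
      · intro b _ hb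
        rw [integral_const_mul, integral_coinStep_mul (Ne.symm hb), mul_zero]
      · exact fun h => (h ha).elim
    rw [Finset.sum_eq_zero h1, Finset.sum_congr rfl h2]
    simp
  · exact fun a _ => integrable_finsetSum _ fun b _ => (i2 a b).const_mul _
  · exact fun a _ => (i1 a).const_mul _
  · exact integrable_const _
  · exact integrable_finsetSum _ fun a _ => (i1 a).const_mul _
  · exact (integrable_const _).add (integrable_finsetSum _ fun a _ => (i1 a).const_mul _)
  · exact integrable_finsetSum _ fun a _ => integrable_finsetSum _ fun b _ =>
      (i2 a b).const_mul _

/-! ### Two walks meet -/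

lemma choose_central_add_ge (s j : ℕ) (hj : j ^ 2 ≤ s) :
    ((2 * s).choose s : ℝ) * (s - j ^ 2) ≤ (2 * s).choose (s + j) * s := by
  induction j with
  | zero => simp
  | succ j ih =>
    have hjs : j ^ 2 ≤ s := le_trans (Nat.pow_le_pow_left (Nat.le_succ j) 2) hj
    have h := ih hjs
    have hlt : j < s := by nlinarith
    have hrec := Nat.choose_succ_right_eq (2 * s) (s + j)
    have hrec' : ((2 * s).choose (s + (j + 1)) : ℝ) * (s + j + 1) =
        (2 * s).choose (s + j) * (s - j) := by
      have : 2 * s - (s + j) = s - j := by omega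
      rw [this] at hrec
      have := congrArg (Nat.cast (R := ℝ)) hrec
      push_cast [Nat.cast_sub hlt.le] at this
      rw [← add_assoc]
      linarith
    have hs : (0 : ℝ) < s := by exact_mod_cast (by omega : 0 < s)
    have hA0 : (0 : ℝ) ≤ (2 * s).choose s := by positivity
    have hj0 : (0 : ℝ) ≤ j := by positivity
    have hjs' : (j : ℝ) < s := by exact_mod_cast hlt
    have hj2 : ((j : ℝ) + 1) ^ 2 ≤ s := by exact_mod_cast hj
    have hpos : (0 : ℝ) < s + j + 1 := by positivity
    push_cast
    clear ih hrec
    generalize ((2 * s).choose s : ℝ) = A at *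
    generalize ((2 * s).choose (s + j) : ℝ) = B at *
    generalize ((2 * s).choose (s + (j + 1)) : ℝ) = C at *
    have h1 : A * (s - j ^ 2) * (s - j) ≤ C * (s + j + 1) * s := by
      rw [hrec']; nlinarith [mul_le_mul_of_nonneg_right h (sub_nonneg.2 hjs'.le)]
    have h2 : (s - ((j : ℝ) + 1) ^ 2) * (s + j + 1) ≤ (s - (j : ℝ) ^ 2) * (s - j) := by
      nlinarith [mul_nonneg hj0 hj0, mul_nonneg hj0 (sub_nonneg.2 hj2),
        mul_nonneg (mul_nonneg hj0 hj0) hj0]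
    have h3 := mul_le_mul_of_nonneg_left h2 hA0
    nlinarith

lemma choose_central_add_ge' {s j : ℕ} (hs : 1 ≤ s) (hj : 2 * j ^ 2 ≤ s) :
    1 / (4 * s : ℝ) ≤ (2 * s).choose (s + j) * (1 / 4) ^ s := by
  have h1 := choose_central_add_ge s j (by omega)
  have h2 := Nat.four_pow_le_two_mul_self_mul_centralBinom s (by omega)
  rw [Nat.centralBinom] at h2
  have h3 : (4 : ℝ) ^ s ≤ 2 * s * (2 * s).choose s := by exact_mod_cast h2
  have hs' : (0 : ℝ) < s := by exact_mod_cast hs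
  have hj' : 2 * (j : ℝ) ^ 2 ≤ s := by exact_mod_cast hj
  have hp : (0 : ℝ) < 4 ^ s := by positivity
  rw [one_div_pow, mul_one_div, div_le_div_iff₀ (by positivity) hp, one_mul]
  have h4 : ((2 * s).choose s : ℝ) * (s / 2) ≤ (2 * s).choose (s + j) * s :=
    le_trans (mul_le_mul_of_nonneg_left (by linarith) (by positivity)) h1
  linarith

lemma fairCoin_singleton (b : Bool) : fairCoin {b} = 2⁻¹ := by
  rw [fairCoin, PMF.toMeasure_apply_singleton _ _ (MeasurableSet.singleton b)]
  simp

/-- The coins of two walks, one of them complemented, form a sequence of `2 s` tosses, of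
which `s + j` must be heads for the first walk to gain `2 j` on the second. -/
lemma coinLaw_meet_ge {a b : ℤ × ℕ} (hab : a ≠ b) (k : ℤ) {s j : ℕ} (hs : 1 ≤ s)
    (hj : 2 * j ^ 2 ≤ s) :
    1 / (4 * s : ℝ) ≤ coinLaw.real {ξ | ∑ r ∈ Finset.Ico k (k + s), coinStep (ξ a r) =
      ∑ r ∈ Finset.Ico k (k + s), coinStep (ξ b r) + 2 * j} := by
  classical
  set F : Finset ((ℤ × ℕ) × ℤ) := {a, b} ×ˢ Finset.Ico k (k + s) with hF
  have hcard : F.card = 2 * s := by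
    rw [hF, Finset.card_product, Finset.card_pair hab, Int.card_Ico]; simp
  -- the prescribed tosses: heads on `T` for the walk `a`, tails on `T` for the walk `b`
  set g : Finset ((ℤ × ℕ) × ℤ) → (ℤ × ℕ) × ℤ → Bool :=
    fun T i => if i.1 = a then decide (i ∈ T) else !decide (i ∈ T) with hg
  have hgT : ∀ T i, g T i = if i.1 = a then decide (i ∈ T) else !decide (i ∈ T) := fun _ _ => rfl
  set E : Set (ℤ × ℕ → ℤ → Bool) := {ξ | ∑ r ∈ Finset.Ico k (k + s), coinStep (ξ a r) =
      ∑ r ∈ Finset.Ico k (k + s), coinStep (ξ b r) + 2 * j} with hE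
  have hEm : MeasurableSet E := by
    have hm : ∀ p : ℤ × ℕ, Measurable fun ξ : ℤ × ℕ → ℤ → Bool =>
        ∑ r ∈ Finset.Ico k (k + s), coinStep (ξ p r) := fun p =>
      Finset.measurable_sum _ fun r _ => (measurable_of_countable coinStep).comp (by fun_prop)
    exact measurableSet_eq_fun (hm a) ((hm b).add_const _)
  set B : Finset ((ℤ × ℕ) × ℤ) → Set ((ℤ × ℕ) × ℤ → Bool) :=
    fun T => Set.pi F fun i => {g T i} with hB
  have hBm : ∀ T, flatCoinLaw (B T) = ENNReal.ofReal ((1 / 4) ^ s) := fun T => by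
    rw [flatCoinLaw, hB, Measure.infinitePi_pi _ fun i _ => MeasurableSet.singleton _]
    simp only [fairCoin_singleton, Finset.prod_const, hcard]
    rw [ENNReal.ofReal_pow (by norm_num), pow_mul]
    congr 1
    rw [one_div, ENNReal.ofReal_inv_of_pos (by norm_num), ENNReal.inv_pow.symm]
    norm_num
  have hsub : ∀ T ∈ F.powersetCard (s + j),
      B T ⊆ (fun (x : (ℤ × ℕ) × ℤ → Bool) p t => x (p, t)) ⁻¹' E := by
    intro T hT x hx
    rw [Finset.mem_powersetCard] at hT
    have hxa : ∀ r ∈ Finset.Ico k (k + s),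
        coinStep (x (a, r)) = 2 * (if (a, r) ∈ T then 1 else 0) - 1 := fun r hr => by
      have := hx (a, r) (by rw [hF]; exact Finset.mem_coe.2 (Finset.mem_product.2 ⟨by simp, hr⟩))
      rw [Set.mem_singleton_iff.1 this, hgT]
      by_cases h : (a, r) ∈ T <;> simp [coinStep, h]
    have hxb : ∀ r ∈ Finset.Ico k (k + s),
        coinStep (x (b, r)) = 1 - 2 * (if (b, r) ∈ T then 1 else 0) := fun r hr => by
      have := hx (b, r) (by rw [hF]; exact Finset.mem_coe.2 (Finset.mem_product.2 ⟨by simp, hr⟩))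
      rw [Set.mem_singleton_iff.1 this, hgT]
      by_cases h : (b, r) ∈ T <;> simp [coinStep, h, hab.symm]
    have hTcard : (T.card : ℤ) = ∑ r ∈ Finset.Ico k (k + s), (if (a, r) ∈ T then 1 else 0) +
        ∑ r ∈ Finset.Ico k (k + s), (if (b, r) ∈ T then 1 else 0) := by
      have h1 : (T.card : ℤ) = ∑ i ∈ F, if i ∈ T then 1 else 0 := by
        rw [Finset.sum_ite_mem, Finset.inter_eq_right.2 hT.1]; simp
      rw [h1, hF, Finset.sum_product, Finset.sum_pair hab]
    have hTc : (T.card : ℤ) = s + j := by exact_mod_cast hT.2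
    simp only [Set.mem_preimage, hE, Set.mem_ofPred_eq]
    rw [Finset.sum_congr rfl hxa, Finset.sum_congr rfl hxb, Finset.sum_sub_distrib,
      Finset.sum_sub_distrib, ← Finset.mul_sum, ← Finset.mul_sum]
    simp only [Finset.sum_const, Int.card_Ico, add_sub_cancel_left, Int.toNat_natCast,
      nsmul_eq_mul, mul_one]
    linarith
  have hdisj : Set.PairwiseDisjoint (F.powersetCard (s + j) : Set _) B := by
    intro T hT T' hT' hne
    rw [Finset.mem_coe, Finset.mem_powersetCard] at hT hT'
    refine Set.disjoint_left.2 fun x hx hx' => hne ?_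
    have key : ∀ i ∈ F, (i ∈ T ↔ i ∈ T') := fun i hi => by
      have h1 := Set.mem_singleton_iff.1 (hx i hi)
      have h2 := Set.mem_singleton_iff.1 (hx' i hi)
      rw [h1, hgT, hgT] at h2
      split_ifs at h2 with h
      · simpa using h2
      · simpa using h2
    ext i
    by_cases hi : i ∈ F
    · exact key i hi
    · exact iff_of_false (fun h => hi (hT.1 h)) (fun h => hi (hT'.1 h))
  have hle : ENNReal.ofReal ((2 * s).choose (s + j) * (1 / 4) ^ s) ≤ coinLaw E := by
    rw [← measurePreserving_curry.measure_preimage hEm.nullMeasurableSet]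
    refine le_trans (le_of_eq ?_) (measure_mono (Set.iUnion₂_subset hsub))
    rw [measure_biUnion_finset hdisj fun T _ =>
      MeasurableSet.pi F.countable_toSet fun i _ => MeasurableSet.singleton _]
    simp only [hBm, Finset.sum_const, Finset.card_powersetCard, hcard, nsmul_eq_mul]
    rw [ENNReal.ofReal_mul (by positivity), ENNReal.ofReal_natCast]
  rw [Measure.real]
  exact (choose_central_add_ge' hs hj).trans
    ((ENNReal.ofReal_le_iff_le_toReal (measure_ne_top _ _)).1 hle)

/-! ### Poisson fields and the size-biased particle system -/

lemma lintegral_poissonMeasure (r : NNReal) (f : ℕ → ℝ≥0∞) :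
    ∫⁻ n, f n ∂poissonMeasure r =
      ∑' n : ℕ, ENNReal.ofReal (Real.exp (-r) * r ^ n / n.factorial) * f n := by
  rw [poissonMeasure, lintegral_sum_measure]
  simp

lemma lintegral_natCast_poissonMeasure_one : ∫⁻ n, (n : ℝ≥0∞) ∂poissonMeasure 1 = 1 := by
  have h1 : ∫⁻ _, 1 ∂poissonMeasure 1 = 1 := by simp
  rw [lintegral_poissonMeasure] at h1 ⊢
  rw [tsum_eq_zero_add' ENNReal.summable]
  simp only [Nat.cast_zero, mul_zero, zero_add]
  rw [← h1]
  refine tsum_congr fun n => ?_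
  rw [← ENNReal.ofReal_natCast, ← ENNReal.ofReal_mul (by positivity), mul_one]
  congr 1
  rw [Nat.factorial_succ]
  push_cast
  field_simp
  simp

/-- The probability generating function of the Poisson law of mean one. -/
lemma lintegral_pow_poissonMeasure_one (r : NNReal) :
    ∫⁻ n, (r : ℝ≥0∞) ^ n ∂poissonMeasure 1 = ENNReal.ofReal (Real.exp (r - 1)) := by
  -- the series is `exp (r - 1)` times the total mass of the Poisson law of mean `r`
  have h1 : ∫⁻ _, 1 ∂poissonMeasure r = 1 := by simp
  rw [lintegral_poissonMeasure] at h1 ⊢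
  rw [← mul_one (ENNReal.ofReal (Real.exp (r - 1))), ← h1, ← ENNReal.tsum_mul_left]
  refine tsum_congr fun n => ?_
  rw [mul_one, ← ENNReal.ofReal_mul (by positivity), ← ENNReal.ofReal_coe_nnreal,
    ← ENNReal.ofReal_pow (by positivity), ← ENNReal.ofReal_mul (by positivity)]
  congr 1
  have : Real.exp (r - 1) * (Real.exp (-r) * r ^ n / n.factorial) =
      (Real.exp (r - 1) * Real.exp (-r)) * r ^ n / n.factorial := by ring
  rw [this, ← Real.exp_add]
  have : (r : ℝ) - 1 + -r = -1 := by ring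
  rw [this]
  simp
  ring

/-- The law of the initial occupation numbers. -/
def occLaw : Measure (ℤ → ℕ) := Measure.infinitePi fun _ : ℤ => poissonMeasure 1

instance : IsProbabilityMeasure occLaw := by unfold occLaw; infer_instance

lemma configLaw_eq : configLaw = occLaw.prod coinLaw := rfl

instance : IsProbabilityMeasure configLaw := by rw [configLaw_eq]; infer_instance

/-- The law of the configuration, biased by the number of particles initially at the origin. -/
def biasedConfigLaw : Measure Config := configLaw.withDensity fun c => (c.1 0 : ℝ≥0∞)

lemma measurable_occ_zero : Measurable fun v : ℤ → ℕ => (v 0 : ℝ≥0∞) :=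
  (measurable_of_countable fun n : ℕ => (n : ℝ≥0∞)).comp (measurable_pi_apply 0)

lemma biasedConfigLaw_eq :
    biasedConfigLaw = (occLaw.withDensity fun v => (v 0 : ℝ≥0∞)).prod coinLaw := by
  rw [biasedConfigLaw, prod_withDensity_left measurable_occ_zero, configLaw_eq]

instance : IsProbabilityMeasure (occLaw.withDensity fun v => (v 0 : ℝ≥0∞)) := by
  constructor
  have h : MeasurePreserving (fun v : ℤ → ℕ => v 0) occLaw (poissonMeasure 1) :=
    measurePreserving_eval_infinitePi (fun _ : ℤ => poissonMeasure 1) 0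
  rw [withDensity_apply _ MeasurableSet.univ, Measure.restrict_univ,
    ← lintegral_natCast_poissonMeasure_one, ← h.map_eq,
    lintegral_map (measurable_of_countable _) h.measurable]

instance : IsProbabilityMeasure biasedConfigLaw := by rw [biasedConfigLaw_eq]; infer_instance

lemma measurable_config_occ_zero : Measurable fun c : Config => (c.1 0 : ℝ≥0∞) :=
  measurable_occ_zero.comp measurable_fst

lemma ae_biasedConfigLaw_occ_zero : ∀ᵐ c ∂biasedConfigLaw, 1 ≤ c.1 0 := by
  rw [biasedConfigLaw, ae_withDensity_iff measurable_config_occ_zero]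
  refine ae_of_all _ fun c hc => ?_
  have : c.1 0 ≠ 0 := by exact_mod_cast hc
  omega

/-- Undoing the size bias costs a factor `1 / v(0, 0)`. -/
lemma integral_indicator_biasedConfigLaw_le {B : Set Config} (hB : MeasurableSet B)
    {g : Config → ℝ} (hg : ∀ c : Config, 1 ≤ c.1 0 → g c ≤ 1 / c.1 0) (hg0 : ∀ c, 0 ≤ g c)
    (hgm : Measurable g) :
    ∫ c, B.indicator g c ∂biasedConfigLaw ≤ configLaw.real B := by
  rw [integral_eq_lintegral_of_nonneg_ae (ae_of_all _ fun c => Set.indicator_nonneg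
    (fun c _ => hg0 c) c) (hgm.indicator hB).aestronglyMeasurable]
  refine ENNReal.toReal_mono (measure_ne_top _ _) ?_
  rw [biasedConfigLaw, lintegral_withDensity_eq_lintegral_mul _ measurable_config_occ_zero
    (hgm.indicator hB).ennreal_ofReal, ← lintegral_indicator_one hB]
  refine lintegral_mono fun c => ?_
  by_cases hc : c ∈ B
  · simp only [Pi.mul_apply, Set.indicator_of_mem hc, Pi.one_apply]
    rcases Nat.eq_zero_or_pos (c.1 0) with h | h
    · simp [h]
    · rw [← ENNReal.ofReal_natCast, ← ENNReal.ofReal_mul (by positivity)]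
      have h' : (0 : ℝ) < c.1 0 := by exact_mod_cast h
      refine ENNReal.ofReal_le_one.2 ?_
      calc (c.1 0 : ℝ) * g c ≤ c.1 0 * (1 / c.1 0) := by gcongr; exact hg c h
        _ = 1 := by field_simp
  · simp [hc]

/-- The configuration `c` with the tosses from time `k` on replaced by those of `ξ'`. -/
def resample (k : ℕ) (c : Config) (ξ' : ℤ × ℕ → ℤ → Bool) : Config := (c.1, splice k c.2 ξ')

lemma measurable_uncurry_resample (k : ℕ) :
    Measurable fun x : Config × (ℤ × ℕ → ℤ → Bool) => resample k x.1 x.2 :=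
  (by fun_prop : Measurable fun x : Config × (ℤ × ℕ → ℤ → Bool) => x.1.1).prodMk
    ((measurable_splice k).comp (by fun_prop :
      Measurable fun x : Config × (ℤ × ℕ → ℤ → Bool) => (x.1.2, x.2)))

lemma measurable_resample (k : ℕ) (c : Config) : Measurable (resample k c) :=
  (measurable_uncurry_resample k).comp (measurable_prodMk_left (x := c))

lemma measurePreserving_resample (k : ℕ) :
    MeasurePreserving (fun x : Config × (ℤ × ℕ → ℤ → Bool) => resample k x.1 x.2)
      (biasedConfigLaw.prod coinLaw) biasedConfigLaw := by
  rw [biasedConfigLaw_eq]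
  exact ((MeasurePreserving.id _).prod (measurePreserving_splice k)).comp
    (measurePreserving_prodAssoc _ _ _)

/-- The tower property for the configuration up to time `k`. -/
lemma integral_integral_resample (k : ℕ) {h : Config → ℝ} (hh : Integrable h biasedConfigLaw) :
    ∫ c, ∫ ξ', h (resample k c ξ') ∂coinLaw ∂biasedConfigLaw = ∫ c, h c ∂biasedConfigLaw := by
  have hp := measurePreserving_resample k
  have hi := hp.integrable_comp_of_integrable hh
  rw [← integral_prod (fun x : Config × (ℤ × ℕ → ℤ → Bool) => h (resample k x.1 x.2)) hi]
  nth_rw 2 [← hp.map_eq]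
  rw [integral_map hp.measurable.aemeasurable]
  rw [hp.map_eq]; exact hh.aestronglyMeasurable

lemma integrable_integral_resample (k : ℕ) {h : Config → ℝ} (hh : Integrable h biasedConfigLaw) :
    Integrable (fun c : Config => ∫ ξ', h (resample k c ξ') ∂coinLaw) biasedConfigLaw :=
  ((measurePreserving_resample k).integrable_comp_of_integrable hh).integral_prod_left

/-! ### The particle density at a later time -/

lemma walk_eq_add (k : ℤ) (ξ : ℤ → Bool) (t : ℤ) : walk k ξ t = k + walk 0 ξ t := by
  unfold walk; ring

lemma measurable_walk_apply (k t : ℤ) : Measurable fun ξ : ℤ → Bool => walk k ξ t := by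
  unfold walk
  have h : ∀ s : ℤ, Measurable fun ξ : ℤ → Bool => coinStep (ξ s) := fun s =>
    (measurable_of_countable coinStep).comp (measurable_pi_apply s)
  exact (measurable_const.add (Finset.measurable_sum _ fun s _ => h s)).sub
    (Finset.measurable_sum _ fun s _ => h s)

/-- Counting measure is invariant for the walk: the expected number of walks in `I` at time `t`,
one from each site, is `#I`. -/
lemma sum_measureReal_walk_mem (I : Finset ℤ) (t : ℤ) :
    ∑ j ∈ I.biUnion (fun z => Finset.Icc (z - |t|) (z + |t|)),
      (Measure.infinitePi fun _ : ℤ => fairCoin).real {ξ | walk j ξ t ∈ I} = I.card := by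
  classical
  set J := I.biUnion fun z => Finset.Icc (z - |t|) (z + |t|) with hJ
  set μ := Measure.infinitePi fun _ : ℤ => fairCoin
  have hm : ∀ j, MeasurableSet {ξ : ℤ → Bool | walk j ξ t ∈ I} := fun j =>
    measurable_walk_apply j t (MeasurableSet.of_discrete (s := (I : Set ℤ)))
  have h1 : ∀ j, μ.real {ξ | walk j ξ t ∈ I} =
      ∫ ξ, {ξ : ℤ → Bool | walk j ξ t ∈ I}.indicator 1 ξ ∂μ := fun j => by
    rw [integral_indicator_one (hm j)]
  have h2 : ∀ ξ : ℤ → Bool,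
      ∑ j ∈ J, {ξ : ℤ → Bool | walk j ξ t ∈ I}.indicator (1 : (ℤ → Bool) → ℝ) ξ = I.card := by
    intro ξ
    simp only [Set.indicator_apply, Set.mem_ofPred_eq, Pi.one_apply, Finset.sum_boole]
    norm_cast
    refine Finset.card_bij (fun j _ => walk j ξ t) ?_ ?_ ?_
    · intro j hj; exact (Finset.mem_filter.1 hj).2
    · intro a _ b _ h
      rw [walk_eq_add a, walk_eq_add b] at h; omega
    · intro z hz
      have hw : walk (z - walk 0 ξ t) ξ t = z := by rw [walk_eq_add]; ring
      refine ⟨z - walk 0 ξ t, Finset.mem_filter.2 ⟨?_, by rwa [hw]⟩, hw⟩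
      exact Finset.mem_biUnion.2 ⟨z, hz, walk_mem_Icc hw⟩
  simp only [h1]
  rw [← integral_finsetSum]
  · simp only [h2]; simp [μ]
  · exact fun j _ => (integrable_const (1 : ℝ)).indicator (hm j)

/-- At any time the particles form a Poisson field of intensity one, so a set of `m` sites is
empty with probability `exp (-m)`. -/
lemma configLaw_empty_le (I : Finset ℤ) (t : ℤ) :
    configLaw {c | ∀ p : ℤ × ℕ, p.2 < c.1 p.1 → walk p.1 (c.2 p) t ∉ I} ≤
      ENNReal.ofReal (Real.exp (-I.card)) := by
  classical
  set J := I.biUnion fun z => Finset.Icc (z - |t|) (z + |t|) with hJ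
  set μ := Measure.infinitePi fun _ : ℤ => fairCoin with hμ
  set E : ℤ → Set (ℤ → Bool) := fun j => {ξ | walk j ξ t ∉ I} with hE
  have hEm : ∀ j, MeasurableSet (E j) := fun j =>
    measurable_walk_apply j t (MeasurableSet.of_discrete (s := (I : Set ℤ)ᶜ))
  set D : Set Config := {c | ∀ p : ℤ × ℕ, p.1 ∈ J → p.2 < c.1 p.1 → c.2 p ∈ E p.1} with hD
  have hDm : MeasurableSet D := by
    have : D = ⋂ p : ℤ × ℕ, {c : Config | p.1 ∈ J → p.2 < c.1 p.1 → c.2 p ∈ E p.1} := by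
      ext c; simp [hD]
    rw [this]
    refine MeasurableSet.iInter fun p => ?_
    have m1 : MeasurableSet {c : Config | p.2 < c.1 p.1} :=
      ((measurable_pi_apply p.1).comp measurable_fst)
        (MeasurableSet.of_discrete (s := {m | p.2 < m}))
    have m2 : MeasurableSet {c : Config | c.2 p ∈ E p.1} :=
      ((measurable_pi_apply p).comp measurable_snd) (hEm p.1)
    by_cases hp : p.1 ∈ J
    · simp only [hp, true_imp_iff]
      exact m1.imp m2
    · simp [hp]
  refine (measure_mono (t := D) ?_).trans ?_
  · exact fun c hc p _ hp => hc p hp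
  rw [configLaw_eq, Measure.prod_apply hDm]
  have hsec : ∀ v : ℤ → ℕ, coinLaw (Prod.mk v ⁻¹' D) = ∏ j ∈ J, μ (E j) ^ v j := by
    intro v
    set F : Finset (ℤ × ℕ) := (J.sigma fun j => Finset.range (v j)).image fun x => (x.1, x.2)
      with hF
    have : Prod.mk v ⁻¹' D = Set.pi F fun p => E p.1 := by
      ext ξ
      simp only [hD, hF, Set.mem_preimage, Set.mem_ofPred_eq, Set.mem_pi, Finset.mem_coe,
        Finset.mem_image, Finset.mem_sigma, Finset.mem_range]
      constructor
      · rintro h p ⟨x, ⟨hx1, hx2⟩, rfl⟩; exact h _ hx1 hx2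
      · intro h p hp1 hp2; exact h p ⟨⟨p.1, p.2⟩, ⟨hp1, hp2⟩, rfl⟩
    rw [this, coinLaw, Measure.infinitePi_pi _ fun p _ => hEm p.1, hF, Finset.prod_image,
      Finset.prod_sigma]
    · simp [hμ]
    · rintro ⟨a, b⟩ _ ⟨a', b'⟩ _ h
      obtain ⟨rfl, rfl⟩ := Prod.mk.inj h
      rfl
  simp only [hsec]
  have hpm : ∀ j, Measurable fun n : ℕ => μ (E j) ^ n := fun j => measurable_of_countable _
  have hind : iIndepFun (fun (j : ℤ) (v : ℤ → ℕ) => μ (E j) ^ v j) occLaw :=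
    iIndepFun_infinitePi (X := fun j (n : ℕ) => μ (E j) ^ n) hpm
  rw [lintegral_prod_eq_prod_lintegral_of_indepFun J _ hind
    fun j => (hpm j).comp (measurable_pi_apply j)]
  have hone : ∀ j, ∫⁻ v, μ (E j) ^ v j ∂occLaw =
      ENNReal.ofReal (Real.exp (-μ.real {ξ | walk j ξ t ∈ I})) := by
    intro j
    have hmp : MeasurePreserving (fun v : ℤ → ℕ => v j) occLaw (poissonMeasure 1) :=
      measurePreserving_eval_infinitePi (fun _ : ℤ => poissonMeasure 1) j
    have h1 := lintegral_pow_poissonMeasure_one (μ (E j)).toNNReal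
    rw [← hmp.map_eq, lintegral_map (measurable_of_countable _) hmp.measurable,
      ENNReal.coe_toNNReal (measure_ne_top _ _)] at h1
    rw [h1]
    congr 2
    have h2 : E j = {ξ | walk j ξ t ∈ I}ᶜ := rfl
    have h3 : (((μ (E j)).toNNReal : NNReal) : ℝ) = μ.real (E j) := rfl
    have h4 : MeasurableSet {ξ : ℤ → Bool | walk j ξ t ∈ I} :=
      measurable_walk_apply j t (MeasurableSet.of_discrete (s := (I : Set ℤ)))
    rw [h3, h2, probReal_compl_eq_one_sub h4]
    ring
  simp only [hone]
  rw [← ENNReal.ofReal_prod_of_nonneg fun j _ => (Real.exp_pos _).le, ← Real.exp_sum,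
    Finset.sum_neg_distrib, sum_measureReal_walk_mem I t]

/-! ### The quenched mass carried by the particles -/

/-- The position of the particle `p` at time `t`. -/
def pos (c : Config) (p : ℤ × ℕ) (t : ℤ) : ℤ := walk p.1 (c.2 p) t

/-- The particles started in `[-K, K]`, as a finite set; it holds all particles that are in
`[-k, k]` at time `k` once `2 * k ≤ K`. -/
def particles (v : ℤ → ℕ) (K : ℕ) : Finset (ℤ × ℕ) :=
  ((Finset.Icc (-K : ℤ) K).sigma fun j => Finset.range (v j)).image fun x => (x.1, x.2)

lemma mem_particles {v : ℤ → ℕ} {K : ℕ} {p : ℤ × ℕ} :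
    p ∈ particles v K ↔ |p.1| ≤ K ∧ p.2 < v p.1 := by
  simp only [particles, Finset.mem_image, Finset.mem_sigma, Finset.mem_Icc, Finset.mem_range,
    abs_le]
  constructor
  · rintro ⟨x, h, rfl⟩; exact h
  · exact fun h => ⟨⟨p.1, p.2⟩, h, rfl⟩

lemma abs_start_le (c : Config) (p : ℤ × ℕ) (t : ℤ) : |p.1| ≤ |pos c p t| + |t| := by
  have h := abs_walk_sub_le p.1 (c.2 p) t
  have h2 := abs_sub_abs_le_abs_sub p.1 (walk p.1 (c.2 p) t)
  rw [abs_sub_comm] at h2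
  unfold pos
  omega

lemma walk_add (k : ℤ) (ξ : ℤ → Bool) (t s : ℕ) :
    walk k ξ (t + s) = walk k ξ t + ∑ r ∈ Finset.Ico (t : ℤ) (t + s), coinStep (ξ r) := by
  have h1 : Finset.Ico ((t : ℤ) + s) 0 = ∅ := Finset.Ico_eq_empty (by omega)
  have h2 : Finset.Ico (t : ℤ) 0 = ∅ := Finset.Ico_eq_empty (by omega)
  have h3 : Disjoint (Finset.Ico (0 : ℤ) t) (Finset.Ico (t : ℤ) (t + s)) :=
    Finset.Ico_disjoint_Ico_consecutive _ _ _
  have h4 : Finset.Ico (0 : ℤ) (t + s) = Finset.Ico (0 : ℤ) t ∪ Finset.Ico (t : ℤ) (t + s) :=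
    (Finset.Ico_union_Ico_eq_Ico (by omega) (by omega)).symm
  rw [walk, walk, h1, h2, h4, Finset.sum_union h3]
  simp
  ring

lemma pos_add (c : Config) (p : ℤ × ℕ) (t s : ℕ) :
    pos c p (t + s) = pos c p t + ∑ r ∈ Finset.Ico (t : ℤ) (t + s), coinStep (c.2 p r) :=
  walk_add _ _ _ _

lemma pos_succ (c : Config) (p : ℤ × ℕ) (t : ℕ) :
    pos c p (t + 1) = pos c p t + coinStep (c.2 p t) := by
  have h : Finset.Ico (t : ℤ) (t + 1) = {(t : ℤ)} := by ext; simp; omega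
  have := pos_add c p t 1
  push_cast at this
  rw [this, h, Finset.sum_singleton]

lemma pos_zero (c : Config) (p : ℤ × ℕ) : pos c p 0 = p.1 := by simp [pos, walk]

lemma coinStep_eq_or (b : Bool) : coinStep b = 1 ∨ coinStep b = -1 := by
  cases b <;> simp [coinStep]

lemma ncard_crossers (c : Config) {t y : ℤ} (y' : ℤ) {K : ℕ} (h : |y| + |t| ≤ K) :
    (crossers c t y y').ncard =
      ((particles c.1 K).filter fun p => pos c p t = y ∧ pos c p (t + 1) = y').card := by
  rw [← Set.ncard_coe_finset]
  congr 1
  ext p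
  simp only [crossers, Set.mem_ofPred_eq, Finset.coe_filter, mem_particles]
  constructor
  · rintro ⟨h1, h2, h3⟩
    refine ⟨⟨(abs_start_le c p t).trans ?_, h1⟩, h2, h3⟩
    rw [show pos c p t = y from h2]; exact h
  · rintro ⟨⟨_, h1⟩, h2, h3⟩; exact ⟨h1, h2, h3⟩

lemma occ_envOf (c : Config) {t : ℕ} {y : ℤ} {K : ℕ} (h : |y| + t ≤ K) :
    occ (envOf c) (t, y) = ((particles c.1 K).filter fun p => pos c p t = y).card := by
  have ht : |y| + |(t : ℤ)| ≤ K := by simpa using h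
  simp only [occ, ePlus, eMinus, envOf]
  rw [ncard_crossers c _ ht, ncard_crossers c _ ht, ← Finset.card_union_of_disjoint]
  · congr 1
    ext p
    simp only [Finset.mem_union, Finset.mem_filter, pos_succ]
    constructor
    · rintro (⟨h1, h2, _⟩ | ⟨h1, h2, _⟩) <;> exact ⟨h1, h2⟩
    · rintro ⟨h1, h2⟩
      rcases coinStep_eq_or (c.2 p t) with h | h
      · exact Or.inl ⟨h1, h2, by omega⟩
      · exact Or.inr ⟨h1, h2, by omega⟩
  · rw [Finset.disjoint_left]
    intro p h1 h2
    have := (Finset.mem_filter.1 h1).2.2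
    have := (Finset.mem_filter.1 h2).2.2
    omega

lemma occ_envOf_zero (c : Config) : occ (envOf c) (0, 0) = c.1 0 := by
  have h := occ_envOf c (t := 0) (y := 0) (K := 0) (by simp)
  simp only [Nat.cast_zero] at h
  rw [h]
  have : ((particles c.1 0).filter fun p => pos c p 0 = 0) =
      (Finset.range (c.1 0)).image fun i => ((0 : ℤ), i) := by
    ext ⟨j, i⟩
    simp only [Finset.mem_filter, mem_particles, pos_zero, Finset.mem_image, Finset.mem_range,
      Prod.mk.injEq]
    constructor
    · rintro ⟨⟨_, h2⟩, rfl⟩; exact ⟨i, h2, rfl, rfl⟩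
    · rintro ⟨i', h, rfl, rfl⟩; simpa using h
  rw [this, Finset.card_image_of_injective _ fun a b h => (Prod.mk.inj h).2, Finset.card_range]

/-- The mass per particle at the site `y` at time `k`. -/
def share (ω : Env) (k : ℕ) (y : ℤ) : ℝ := massAt ω k y / occ ω (k, y)

lemma share_nonneg (ω : Env) (k : ℕ) (y : ℤ) : 0 ≤ share ω k y :=
  div_nonneg (massAt_nonneg _ _ _) (Nat.cast_nonneg _)

lemma share_eq_zero (ω : Env) {k : ℕ} {y : ℤ} (h : (k : ℤ) < |y|) : share ω k y = 0 := by
  rw [share, massAt_eq_zero ω h, zero_div]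

/-- The share of mass of the particle `p` at time `k`. -/
def shareOf (c : Config) (k : ℕ) (p : ℤ × ℕ) : ℝ := share (envOf c) k (pos c p k)

/-- The particles at a site together carry its mass, provided that empty sites carry none. The
finite family `particles c.1 K` holds every particle that can be in `[-k, k]` at time `k`. -/
lemma sum_shareOf_of_occ (c : Config) {k K : ℕ} (hK : 2 * k ≤ K)
    (hocc : ∀ y, occ (envOf c) (k, y) = 0 → massAt (envOf c) k y = 0) (y : ℤ) :
    ∑ p ∈ particles c.1 K with pos c p k = y, shareOf c k p = massAt (envOf c) k y := by
  have h1 : ∀ p ∈ (particles c.1 K).filter (fun p => pos c p k = y),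
      shareOf c k p = share (envOf c) k y := fun p hp => by
    rw [shareOf, (Finset.mem_filter.1 hp).2]
  rw [Finset.sum_congr rfl h1, Finset.sum_const, nsmul_eq_mul]
  rcases le_or_gt |y| (k : ℤ) with hy | hy
  · rw [← occ_envOf c (by omega), share]
    by_cases h0 : occ (envOf c) (k, y) = 0
    · simp [h0, hocc y h0]
    · have : (occ (envOf c) (k, y) : ℝ) ≠ 0 := by exact_mod_cast h0
      field_simp
  · rw [share_eq_zero _ hy, massAt_eq_zero _ hy, mul_zero]

/-- The mass at a site at time `k + 1` is brought there by the particles that jump to it. -/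
lemma sum_shareOf_next_of_occ (c : Config) {k K : ℕ} (hK : 2 * k + 2 ≤ K)
    (hocc : ∀ y, occ (envOf c) (k, y) = 0 → massAt (envOf c) k y = 0) (y : ℤ) :
    ∑ p ∈ particles c.1 K with pos c p (k + 1 : ℕ) = y, shareOf c k p =
      massAt (envOf c) (k + 1) y := by
  push_cast
  rcases le_or_gt |y| (k + 1 : ℤ) with hy | hy
  · have hs : (particles c.1 K).filter (fun p => pos c p (k + 1) = y) =
        (particles c.1 K).filter (fun p => pos c p k = y - 1 ∧ pos c p (k + 1) = y - 1 + 1) ∪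
        (particles c.1 K).filter (fun p => pos c p k = y + 1 ∧ pos c p (k + 1) = y + 1 - 1) := by
      ext p
      simp only [Finset.mem_union, Finset.mem_filter, pos_succ]
      rcases coinStep_eq_or (c.2 p k) with h | h <;> rw [h] <;> constructor
      · rintro ⟨h1, h2⟩; exact Or.inl ⟨h1, by omega, by omega⟩
      · rintro (⟨h1, h2, h3⟩ | ⟨h1, h2, h3⟩) <;> exact ⟨h1, by omega⟩
      · rintro ⟨h1, h2⟩; exact Or.inr ⟨h1, by omega, by omega⟩
      · rintro (⟨h1, h2, h3⟩ | ⟨h1, h2, h3⟩) <;> exact ⟨h1, by omega⟩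
    have hd : Disjoint
        ((particles c.1 K).filter (fun p => pos c p k = y - 1 ∧ pos c p (k + 1) = y - 1 + 1))
        ((particles c.1 K).filter (fun p => pos c p k = y + 1 ∧ pos c p (k + 1) = y + 1 - 1)) := by
      rw [Finset.disjoint_left]
      intro p h1 h2
      have := (Finset.mem_filter.1 h1).2.1
      have := (Finset.mem_filter.1 h2).2.1
      omega
    have e : ∀ z z' : ℤ, ∀ p ∈ (particles c.1 K).filter
        (fun p => pos c p k = z ∧ pos c p (k + 1) = z'), shareOf c k p = share (envOf c) k z :=
      fun z z' p hp => by rw [shareOf, (Finset.mem_filter.1 hp).2.1]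
    rw [hs, Finset.sum_union hd, Finset.sum_congr rfl (e _ _), Finset.sum_congr rfl (e _ _),
      Finset.sum_const, Finset.sum_const]
    rw [abs_le] at hy
    rw [← ncard_crossers c (t := k) (y := y - 1) (y - 1 + 1) (by
        have : |y - 1| ≤ k + 2 := by rw [abs_le]; omega
        simp only [Nat.abs_cast]; omega),
      ← ncard_crossers c (t := k) (y := y + 1) (y + 1 - 1) (by
        have : |y + 1| ≤ k + 2 := by rw [abs_le]; omega
        simp only [Nat.abs_cast]; omega)]
    have h3 : (if occ (envOf c) (k, y) = 0 then massAt (envOf c) k y else 0) = 0 := by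
      split_ifs with h
      · exact hocc y h
      · rfl
    rw [massAt, h3]
    simp only [share, ePlus, eMinus, nsmul_eq_mul, add_zero]
    simp only [envOf]
    ring
  · rw [massAt_eq_zero _ (by exact_mod_cast hy)]
    refine Finset.sum_eq_zero fun p hp => share_eq_zero _ ?_
    have h1 := (Finset.mem_filter.1 hp).2
    rw [pos_succ] at h1
    rw [lt_abs] at hy ⊢
    rcases coinStep_eq_or (c.2 p k) with h | h <;> rw [h] at h1 <;> omega

/-- If the origin is occupied at time zero, then the quenched walk visits occupied sites only. -/
lemma massAt_eq_zero_of_occ {c : Config} (h0 : 1 ≤ c.1 0) (k : ℕ) (y : ℤ)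
    (h : occ (envOf c) (k, y) = 0) : massAt (envOf c) k y = 0 := by
  induction k generalizing y with
  | zero =>
    have : y ≠ 0 := by
      rintro rfl
      rw [Nat.cast_zero, occ_envOf_zero] at h
      omega
    simp [massAt, this]
  | succ k ih =>
    rw [← sum_shareOf_next_of_occ c (K := y.natAbs + 2 * k + 2) (by omega) ih]
    rw [occ_envOf c (K := y.natAbs + 2 * k + 2) (by rw [← Int.natCast_natAbs]; push_cast; omega),
      Finset.card_eq_zero] at h
    rw [h, Finset.sum_empty]

lemma sum_comp_pos_mul (c : Config) (P : Finset (ℤ × ℕ)) (t : ℤ) (h : ℤ → ℝ) (f : ℤ × ℕ → ℝ) :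
    ∑ p ∈ P, h (pos c p t) * f p =
      ∑ y ∈ P.image fun p => pos c p t, h y * ∑ p ∈ P with pos c p t = y, f p := by
  rw [← Finset.sum_fiberwise_of_maps_to (t := P.image fun p => pos c p t)
    fun p hp => Finset.mem_image_of_mem _ hp]
  refine Finset.sum_congr rfl fun y _ => ?_
  rw [Finset.mul_sum]
  refine Finset.sum_congr rfl fun p hp => ?_
  rw [(Finset.mem_filter.1 hp).2]

/-- The particles at a site pool their shares and divide them equally, so that sums of the shares
against functions of the new position are unchanged. -/
lemma sum_mul_shareOf_succ {c : Config} (h0 : 1 ≤ c.1 0) {k K : ℕ} (hK : 2 * k + 2 ≤ K)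
    (h : ℤ → ℝ) :
    ∑ p ∈ particles c.1 K, h (pos c p (k + 1 : ℕ)) * shareOf c (k + 1) p =
      ∑ p ∈ particles c.1 K, h (pos c p (k + 1 : ℕ)) * shareOf c k p := by
  rw [sum_comp_pos_mul, sum_comp_pos_mul]
  refine Finset.sum_congr rfl fun y _ => ?_
  rw [sum_shareOf_of_occ c (by omega) (massAt_eq_zero_of_occ h0 _),
    sum_shareOf_next_of_occ c hK (massAt_eq_zero_of_occ h0 _)]

lemma sum_mul_shareOf {c : Config} (h0 : 1 ≤ c.1 0) {k K : ℕ} (hK : 2 * k ≤ K) (h : ℤ → ℝ) :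
    ∑ p ∈ particles c.1 K, h (pos c p k) * shareOf c k p =
      ∑ y ∈ Finset.Icc (-k : ℤ) k, h y * massAt (envOf c) k y := by
  rw [sum_comp_pos_mul]
  simp only [sum_shareOf_of_occ c hK (massAt_eq_zero_of_occ h0 _)]
  -- both sums may be extended over the union of the two ranges
  set A := (particles c.1 K).image fun p => pos c p k with hA
  have h1 : ∑ y ∈ A, h y * massAt (envOf c) k y =
      ∑ y ∈ A ∪ Finset.Icc (-k : ℤ) k, h y * massAt (envOf c) k y := by
    refine Finset.sum_subset Finset.subset_union_left fun y _ hy => ?_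
    rw [← sum_shareOf_of_occ c hK (massAt_eq_zero_of_occ h0 _), Finset.sum_eq_zero, mul_zero]
    intro p hp
    rw [Finset.mem_filter] at hp
    exact (hy (Finset.mem_image.2 ⟨p, hp.1, hp.2⟩)).elim
  have h2 : ∑ y ∈ Finset.Icc (-k : ℤ) k, h y * massAt (envOf c) k y =
      ∑ y ∈ A ∪ Finset.Icc (-k : ℤ) k, h y * massAt (envOf c) k y := by
    refine Finset.sum_subset Finset.subset_union_right fun y _ hy => ?_
    rw [Finset.mem_Icc] at hy
    rw [massAt_eq_zero _ (by rw [lt_abs]; omega), mul_zero]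
  exact h1.trans h2.symm

lemma quenchedDrift_eq {c : Config} (h0 : 1 ≤ c.1 0) {k K : ℕ} (hK : 2 * k ≤ K) :
    quenchedDrift (envOf c) k = ∑ p ∈ particles c.1 K, pos c p k * shareOf c k p := by
  rw [sum_mul_shareOf h0 hK fun y => (y : ℝ), quenchedDrift]
  exact Finset.sum_congr rfl fun y _ => mul_comm _ _

lemma quenchedDrift_succ {c : Config} (h0 : 1 ≤ c.1 0) {k K : ℕ} (hK : 2 * k + 2 ≤ K) :
    quenchedDrift (envOf c) (k + 1) = quenchedDrift (envOf c) k +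
      ∑ p ∈ particles c.1 K, shareOf c k p * coinStep (c.2 p k) := by
  rw [quenchedDrift_eq h0 (k := k + 1) (K := K) (by omega),
    quenchedDrift_eq h0 (K := K) (by omega),
    sum_mul_shareOf_succ h0 hK fun y => (y : ℝ), ← Finset.sum_add_distrib]
  refine Finset.sum_congr rfl fun p _ => ?_
  push_cast
  rw [pos_succ]
  push_cast
  ring

/-- The energy `∑_y ℙ^ω(X_k = (k, y))² / v(k, y)`: the conditional variance of the increment of
the quenched mean, and the squared `ℓ²` norm of the shares of the particles. -/
def energy (ω : Env) (k : ℕ) : ℝ :=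
  ∑ y ∈ Finset.Icc (-k : ℤ) k, massAt ω k y ^ 2 / occ ω (k, y)

lemma energy_nonneg (ω : Env) (k : ℕ) : 0 ≤ energy ω k :=
  Finset.sum_nonneg fun _ _ => by positivity

lemma energy_eq {c : Config} (h0 : 1 ≤ c.1 0) {k K : ℕ} (hK : 2 * k ≤ K) :
    energy (envOf c) k = ∑ p ∈ particles c.1 K, shareOf c k p ^ 2 := by
  have := sum_mul_shareOf h0 hK fun y => share (envOf c) k y
  simp only [sq]
  rw [energy]
  refine Eq.trans (Finset.sum_congr rfl fun y _ => ?_) this.symm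
  rw [share]; ring

/-- The pooling of shares is an orthogonal projection, so Pythagoras' theorem holds. -/
lemma energy_succ {c : Config} (h0 : 1 ≤ c.1 0) {k K : ℕ} (hK : 2 * k + 2 ≤ K) :
    energy (envOf c) (k + 1) +
      ∑ p ∈ particles c.1 K, (shareOf c (k + 1) p - shareOf c k p) ^ 2 = energy (envOf c) k := by
  have := sum_mul_shareOf_succ h0 hK fun y => share (envOf c) (k + 1) y
  rw [energy_eq h0 (k := k + 1) (K := K) (by omega), energy_eq h0 (K := K) (by omega),
    ← Finset.sum_add_distrib]
  have e : ∀ p, shareOf c (k + 1) p ^ 2 + (shareOf c (k + 1) p - shareOf c k p) ^ 2 =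
      shareOf c k p ^ 2 + 2 * (shareOf c (k + 1) p * shareOf c (k + 1) p -
        shareOf c (k + 1) p * shareOf c k p) := fun p => by ring
  simp only [e]
  rw [Finset.sum_add_distrib, ← Finset.mul_sum, Finset.sum_sub_distrib]
  rw [show ∑ p ∈ particles c.1 K, shareOf c (k + 1) p * shareOf c (k + 1) p =
    ∑ p ∈ particles c.1 K, shareOf c (k + 1) p * shareOf c k p from this]
  ring

lemma energy_antitone {c : Config} (h0 : 1 ≤ c.1 0) : Antitone (energy (envOf c)) := by
  refine antitone_nat_of_succ_le fun k => ?_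
  rw [← energy_succ h0 (le_refl (2 * k + 2))]
  exact le_add_of_nonneg_right (Finset.sum_nonneg fun _ _ => sq_nonneg _)

lemma energy_le {c : Config} (h0 : 1 ≤ c.1 0) (k : ℕ) : energy (envOf c) k ≤ 1 / c.1 0 := by
  refine (energy_antitone h0 (Nat.zero_le k)).trans ?_
  simp [energy, massAt, occ_envOf_zero]

lemma energy_le_one {c : Config} (h0 : 1 ≤ c.1 0) (k : ℕ) : energy (envOf c) k ≤ 1 := by
  refine (energy_le h0 k).trans ?_
  have : (1 : ℝ) ≤ c.1 0 := by exact_mod_cast h0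
  exact div_le_one_of_le₀ this (by positivity)

lemma energy_add {c : Config} (h0 : 1 ≤ c.1 0) (k s : ℕ) {K : ℕ} (hK : 2 * (k + s) ≤ K) :
    energy (envOf c) (k + s) + ∑ p ∈ particles c.1 K,
      ∑ r ∈ Finset.range s, (shareOf c (k + r + 1) p - shareOf c (k + r) p) ^ 2 =
    energy (envOf c) k := by
  rw [Finset.sum_comm]
  induction s with
  | zero => simp
  | succ s ih =>
    rw [Finset.sum_range_succ, ← ih (by omega), ← energy_succ h0 (k := k + s) (K := K) (by omega)]
    ring_nf

/-- If two particles are at the same site at time `k + s`, the difference of their shares at time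
`k` is controlled by the fluctuations of their shares in between. -/
lemma sq_shareOf_sub_le (c : Config) (k s : ℕ) {p q : ℤ × ℕ}
    (h : pos c p (k + s : ℕ) = pos c q (k + s : ℕ)) :
    (shareOf c k p - shareOf c k q) ^ 2 ≤
      2 * s * (∑ r ∈ Finset.range s, (shareOf c (k + r + 1) p - shareOf c (k + r) p) ^ 2 +
        ∑ r ∈ Finset.range s, (shareOf c (k + r + 1) q - shareOf c (k + r) q) ^ 2) := by
  have tel : ∀ p, (shareOf c (k + s) p - shareOf c k p) ^ 2 ≤
      s * ∑ r ∈ Finset.range s, (shareOf c (k + r + 1) p - shareOf c (k + r) p) ^ 2 := fun p => by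
    have h1 := Finset.sum_range_sub (fun r => shareOf c (k + r) p) s
    have h2 := sq_sum_le_card_mul_sum_sq (s := Finset.range s)
      (f := fun r => shareOf c (k + (r + 1)) p - shareOf c (k + r) p)
    rw [h1, Finset.card_range] at h2
    exact h2
  have hm : shareOf c (k + s) p = shareOf c (k + s) q := by rw [shareOf, shareOf, h]
  have hp := tel p
  have hq := tel q
  rw [hm] at hp
  -- `(u - v) ^ 2 ≤ 2 * (u ^ 2 + v ^ 2)` for the displacements `u`, `v` of the two shares
  nlinarith [sq_nonneg ((shareOf c (k + s) q - shareOf c k p) +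
    (shareOf c (k + s) q - shareOf c k q))]

/-- Energy is lost whenever neighbouring particles of a chain meet. -/
lemma sum_sq_shareOf_sub_le {c : Config} (h0 : 1 ≤ c.1 0) (k s : ℕ) {K n : ℕ}
    (hK : 2 * (k + s) ≤ K) {a : ℕ → ℤ × ℕ} (ha : ∀ i ≤ n, a i ∈ particles c.1 K)
    (hinj : Set.InjOn a (Set.Iic n)) :
    ∑ i ∈ Finset.range n, (if pos c (a i) (k + s : ℕ) = pos c (a (i + 1)) (k + s : ℕ) then
      (shareOf c k (a i) - shareOf c k (a (i + 1))) ^ 2 else 0) ≤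
    4 * s * (energy (envOf c) k - energy (envOf c) (k + s)) := by
  rw [← energy_add h0 k s hK, add_sub_cancel_left]
  set D : ℤ × ℕ → ℝ := fun p =>
    ∑ r ∈ Finset.range s, (shareOf c (k + r + 1) p - shareOf c (k + r) p) ^ 2 with hD
  have hD0 : ∀ p, 0 ≤ D p := fun p => Finset.sum_nonneg fun _ _ => sq_nonneg _
  have hsub : ∀ e : ℕ → ℕ, Function.Injective e → (∀ i < n, e i ≤ n) →
      ∑ i ∈ Finset.range n, D (a (e i)) ≤ ∑ p ∈ particles c.1 K, D p := by
    intro e he hen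
    rw [← Finset.sum_image (f := D) (g := fun i => a (e i))]
    · refine Finset.sum_le_sum_of_subset_of_nonneg (Finset.image_subset_iff.2 fun i hi => ?_)
        fun p _ _ => hD0 p
      exact ha _ (hen i (Finset.mem_range.1 hi))
    · intro i hi j hj hij
      exact he (hinj (hen i (Finset.mem_range.1 hi)) (hen j (Finset.mem_range.1 hj)) hij)
  have h1 := hsub id Function.injective_id fun i hi => hi.le
  have h2 := hsub Nat.succ Nat.succ_injective fun i hi => hi
  calc _ ≤ ∑ i ∈ Finset.range n, 2 * (s : ℝ) * (D (a i) + D (a (i + 1))) := by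
        refine Finset.sum_le_sum fun i _ => ?_
        split_ifs with h
        · exact sq_shareOf_sub_le c k s h
        · exact mul_nonneg (by positivity) (add_nonneg (hD0 _) (hD0 _))
    _ = 2 * s * (∑ i ∈ Finset.range n, D (a (id i)) + ∑ i ∈ Finset.range n, D (a (i.succ))) := by
        rw [← Finset.mul_sum, Finset.sum_add_distrib]; rfl
    _ ≤ 2 * s * (∑ p ∈ particles c.1 K, D p + ∑ p ∈ particles c.1 K, D p) := by gcongr
    _ = _ := by ring

/-! ### Measurability -/

lemma measurable_ePlus (z : ℤ × ℤ) : Measurable fun ω : Env => ePlus ω z :=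
  measurable_fst.comp (measurable_pi_apply z)

lemma measurable_eMinus (z : ℤ × ℤ) : Measurable fun ω : Env => eMinus ω z :=
  measurable_snd.comp (measurable_pi_apply z)

lemma measurable_occ (z : ℤ × ℤ) : Measurable fun ω : Env => occ ω z :=
  (measurable_ePlus z).add (measurable_eMinus z)

lemma measurable_natCast_comp {α : Type*} [MeasurableSpace α] {f : α → ℕ} (hf : Measurable f) :
    Measurable fun x => (f x : ℝ) :=
  (measurable_of_countable fun n : ℕ => (n : ℝ)).comp hf

lemma measurable_massAt (k : ℕ) (y : ℤ) : Measurable fun ω : Env => massAt ω k y := by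
  induction k generalizing y with
  | zero => exact measurable_const
  | succ k ih =>
    simp only [massAt]
    refine (((ih _).mul ((measurable_natCast_comp (measurable_ePlus _)).div
      (measurable_natCast_comp (measurable_occ _)))).add
      ((ih _).mul ((measurable_natCast_comp (measurable_eMinus _)).div
      (measurable_natCast_comp (measurable_occ _))))).add ?_
    exact Measurable.ite (measurable_occ _ (MeasurableSet.singleton 0)) (ih _) measurable_const

lemma measurable_energy (k : ℕ) : Measurable fun ω : Env => energy ω k :=
  Finset.measurable_sum _ fun y _ => ((measurable_massAt k y).pow_const 2).div
    (measurable_natCast_comp (measurable_occ _))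

lemma measurable_quenchedDrift (k : ℕ) : Measurable fun ω : Env => quenchedDrift ω k :=
  Finset.measurable_sum _ fun y _ => (measurable_massAt k y).mul_const _

/-! ### Resampling the tosses after time `k` -/

lemma pos_resample {k : ℕ} (c : Config) (ξ' : ℤ × ℕ → ℤ → Bool) (p : ℤ × ℕ) {t : ℤ}
    (ht : t ≤ k) (ht0 : 0 ≤ t) : pos (resample k c ξ') p t = pos c p t := by
  unfold pos walk
  rw [Finset.Ico_eq_empty (a := t) (b := 0) (by omega), Finset.sum_empty, Finset.sum_empty]
  congr 2
  refine Finset.sum_congr rfl fun s hs => ?_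
  rw [Finset.mem_Ico] at hs
  simp [resample, splice, show s < k by omega]

lemma pos_resample_add (k s : ℕ) (c : Config) (ξ' : ℤ × ℕ → ℤ → Bool) (p : ℤ × ℕ) :
    pos (resample k c ξ') p (k + s : ℕ) =
      pos c p k + ∑ r ∈ Finset.Ico (k : ℤ) (k + s), coinStep (ξ' p r) := by
  rw [Nat.cast_add, pos_add, pos_resample c ξ' p le_rfl (by omega)]
  congr 1
  refine Finset.sum_congr rfl fun r hr => ?_
  rw [Finset.mem_Ico] at hr
  simp [resample, splice, show ¬ r < k by omega]

lemma occ_resample {k t : ℕ} (ht : t ≤ k) (c : Config) (ξ' : ℤ × ℕ → ℤ → Bool) (y : ℤ) :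
    occ (envOf (resample k c ξ')) (t, y) = occ (envOf c) (t, y) := by
  have h : |y| + t ≤ (y.natAbs + t : ℕ) := by rw [← Int.natCast_natAbs]; push_cast; omega
  rw [occ_envOf _ h, occ_envOf _ h]
  have h1 : (resample k c ξ').1 = c.1 := rfl
  simp only [h1, pos_resample c ξ' _ (by exact_mod_cast ht : (t : ℤ) ≤ k) (by omega)]

lemma envOf_resample {k : ℕ} (c : Config) (ξ' : ℤ × ℕ → ℤ → Bool) {t : ℕ} (ht : t < k) (y : ℤ) :
    envOf (resample k c ξ') (t, y) = envOf c (t, y) := by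
  have h : ∀ y', crossers (resample k c ξ') t y y' = crossers c t y y' := fun y' => by
    ext p
    have h1 := pos_resample c ξ' p (t := t) (by exact_mod_cast ht.le) (by omega)
    have h2 := pos_resample c ξ' p (t := t + 1) (k := k) (by omega) (by omega)
    unfold pos at h1 h2
    simp only [crossers, Set.mem_ofPred_eq, h1, h2]
    rfl
  simp only [envOf, h]

lemma massAt_resample {k j : ℕ} (hj : j ≤ k) (c : Config) (ξ' : ℤ × ℕ → ℤ → Bool) (y : ℤ) :
    massAt (envOf (resample k c ξ')) j y = massAt (envOf c) j y := by
  induction j generalizing y with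
  | zero => rfl
  | succ j ih =>
    simp only [massAt, occ, ePlus, eMinus, envOf_resample c ξ' (show j < k by omega),
      ih (by omega)]
    congr

lemma shareOf_resample (k : ℕ) (c : Config) (ξ' : ℤ × ℕ → ℤ → Bool) (p : ℤ × ℕ) :
    shareOf (resample k c ξ') k p = shareOf c k p := by
  rw [shareOf, shareOf, share, share, pos_resample c ξ' p le_rfl (by omega),
    massAt_resample le_rfl, occ_resample le_rfl]

lemma energy_resample (k : ℕ) (c : Config) (ξ' : ℤ × ℕ → ℤ → Bool) :
    energy (envOf (resample k c ξ')) k = energy (envOf c) k := by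
  simp only [energy, massAt_resample le_rfl, occ_resample le_rfl]

lemma quenchedDrift_resample (k : ℕ) (c : Config) (ξ' : ℤ × ℕ → ℤ → Bool) :
    quenchedDrift (envOf (resample k c ξ')) k = quenchedDrift (envOf c) k := by
  simp only [quenchedDrift, massAt_resample le_rfl]

/-- The quenched mean is a martingale in `k`, and the energy is the conditional variance of its
increments. -/
lemma integral_quenchedDrift_succ_sq {c : Config} (h0 : 1 ≤ c.1 0) (k : ℕ) :
    ∫ ξ', quenchedDrift (envOf (resample k c ξ')) (k + 1) ^ 2 ∂coinLaw =
      quenchedDrift (envOf c) k ^ 2 + energy (envOf c) k := by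
  have h : ∀ ξ', quenchedDrift (envOf (resample k c ξ')) (k + 1) = quenchedDrift (envOf c) k +
      ∑ p ∈ particles c.1 (2 * k + 2), shareOf c k p * coinStep (ξ' p k) := fun ξ' => by
    rw [quenchedDrift_succ (c := resample k c ξ') h0 le_rfl, quenchedDrift_resample]
    congr 1
    refine Finset.sum_congr rfl fun p _ => ?_
    rw [shareOf_resample]
    simp [resample, splice]
  simp only [h]
  rw [integral_sq_add_sum_coinStep, energy_eq h0 (by omega : 2 * k ≤ 2 * k + 2)]

/-! ### A discrete Nash inequality -/

/-- If every stretch of `N` sites of one parity near the support holds a particle, then a chain of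
occupied sites with gaps at most `4 N` leads from a site of maximal share to a site where the share
is at most half of the maximum `m`. As the total mass is one, the chain has at most `2 / m` links,
so Cauchy-Schwarz bounds its Dirichlet sum from below by `m ^ 3 / 8`; and `m` is at least the
energy. -/
lemma exists_chain {q : ℤ → ℝ} {o : ℤ → ℕ} {k N : ℕ} (hN : 1 ≤ N) (hq0 : ∀ y, 0 ≤ q y)
    (hqk : ∀ y, (k : ℤ) < |y| → q y = 0) (hqo : ∀ y, o y = 0 → q y = 0)
    (hmass : ∑ y ∈ Finset.Icc (-k : ℤ) k, o y * q y = 1)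
    (hgood : ∀ y : ℤ, |y| ≤ (2 * N + 1) * k → ∃ i ∈ Finset.Icc 1 N, o (y + 2 * i) ≠ 0) :
    ∃ (n : ℕ) (z : ℕ → ℤ), (∀ i ≤ n, o (z i) ≠ 0 ∧ |z i| ≤ (2 * N + 1) * k + 2 * N) ∧
      StrictMono z ∧ (∀ i, ∃ j : ℕ, j ≤ 2 * N ∧ z (i + 1) = z i + 2 * j) ∧
      (∑ y ∈ Finset.Icc (-k : ℤ) k, o y * q y ^ 2) ^ 3 / 8 ≤
        ∑ i ∈ Finset.range n, (q (z i) - q (z (i + 1))) ^ 2 := by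
  obtain ⟨x, hx, hmax⟩ := Finset.exists_max_image (Finset.Icc (-k : ℤ) k) q
    ⟨0, by simp⟩
  set m := q x with hm
  rw [Finset.mem_Icc] at hx
  have hm0 : 0 < m := by
    rcases (hq0 x).lt_or_eq with h | h
    · exact h
    · exfalso
      rw [Finset.sum_eq_zero] at hmass
      · exact zero_ne_one hmass
      · intro y hy
        have h1 := hmax y hy
        have h2 := hq0 y
        rw [show q y = 0 by linarith, mul_zero]
  have hox : o x ≠ 0 := fun h => hm0.ne' (hqo x h)
  have hEm : ∑ y ∈ Finset.Icc (-k : ℤ) k, o y * q y ^ 2 ≤ m := by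
    calc ∑ y ∈ Finset.Icc (-k : ℤ) k, o y * q y ^ 2
        ≤ ∑ y ∈ Finset.Icc (-k : ℤ) k, m * (o y * q y) := by
          refine Finset.sum_le_sum fun y hy => ?_
          have := mul_le_mul_of_nonneg_right (hmax y hy)
            (mul_nonneg (Nat.cast_nonneg (o y)) (hq0 y))
          linarith [this, show (o y : ℝ) * q y ^ 2 = q y * (o y * q y) by ring]
      _ = m := by rw [← Finset.mul_sum, hmass, mul_one]
  have hE0 : 0 ≤ ∑ y ∈ Finset.Icc (-k : ℤ) k, o y * q y ^ 2 :=
    Finset.sum_nonneg fun _ _ => by positivity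
  -- outside the range covered by `hgood` the offset `r` is arbitrary
  have hr : ∀ i : ℕ, ∃ r : ℕ, 1 ≤ r ∧ r ≤ N ∧
      (|x + 2 * N * i| ≤ (2 * N + 1) * k → o (x + 2 * N * i + 2 * r) ≠ 0) := fun i => by
    by_cases h : |x + 2 * N * i| ≤ (2 * N + 1) * k
    · obtain ⟨r, hr, ho⟩ := hgood _ h
      rw [Finset.mem_Icc] at hr
      exact ⟨r, hr.1, hr.2, fun _ => ho⟩
    · exact ⟨1, le_rfl, hN, fun h' => (h h').elim⟩
  choose r hr1 hrN hro using hr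
  -- one occupied site in each of the successive stretches of `N` sites to the right of `x`
  set z : ℕ → ℤ := fun i => if i = 0 then x else x + 2 * N * (i - 1 : ℕ) + 2 * r (i - 1) with hz
  have hz0 : z 0 = x := by simp [hz]
  have hzs : ∀ i, z (i + 1) = x + 2 * N * i + 2 * r i := fun i => by simp [hz]
  have hstep : ∀ i, ∃ j : ℕ, (1 ≤ j ∧ j ≤ 2 * N) ∧ z (i + 1) = z i + 2 * j := fun i => by
    rcases i with _ | i
    · exact ⟨r 0, ⟨hr1 0, by have := hrN 0; omega⟩, by rw [hzs, hz0]; simp⟩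
    · refine ⟨N + r (i + 1) - r i, ⟨?_, ?_⟩, ?_⟩
      · have := hrN i; have := hr1 (i + 1); omega
      · have := hrN (i + 1); omega
      · rw [hzs, hzs]
        push_cast [Nat.cast_sub (show r i ≤ N + r (i + 1) by have := hrN i; omega)]
        ring
  have hmono : StrictMono z := strictMono_nat_of_lt_succ fun i => by
    obtain ⟨j, ⟨hj, _⟩, h⟩ := hstep i
    omega
  have hNk : ∀ i : ℕ, i ≤ k → (N : ℤ) * i ≤ N * k := fun i hi => by gcongr
  have hend : q (z (k + 1)) ≤ m / 2 := by
    rw [hqk]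
    · positivity
    · -- `z (k + 1)` is at least `-k + 2 * N * k + 2`, which is beyond the support
      rw [hzs, lt_abs]
      left
      have : (k : ℤ) ≤ N * k := by
        have : (1 : ℤ) * k ≤ N * k := by gcongr; exact_mod_cast hN
        linarith
      linarith [hx.1, (by exact_mod_cast hr1 k : (1 : ℤ) ≤ r k)]
  have hex : ∃ n, q (z n) ≤ m / 2 := ⟨k + 1, hend⟩
  classical
  set n := Nat.find hex with hn
  have hnq : q (z n) ≤ m / 2 := Nat.find_spec hex
  have hnmin : ∀ i < n, m / 2 < q (z i) := fun i hi => not_le.1 (Nat.find_min hex hi)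
  have hnk : n ≤ k + 1 := Nat.find_min' hex hend
  have hn0 : 0 < n := by
    rcases Nat.eq_zero_or_pos n with h | h
    · rw [h, hz0] at hnq; linarith
    · exact h
  refine ⟨n, z, ?_, hmono, fun i => ?_, ?_⟩
  · intro i hi
    rcases i with _ | i
    · rw [hz0]
      refine ⟨hox, ?_⟩
      rw [abs_le]
      have : (0 : ℤ) ≤ N * k := by positivity
      constructor <;> nlinarith
    · have h1 := hNk i (by omega)
      have h2 : (0 : ℤ) ≤ N * i := by positivity
      have h3 : (1 : ℤ) ≤ r i := by exact_mod_cast hr1 i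
      have h4 : (r i : ℤ) ≤ N := by exact_mod_cast hrN i
      rw [hzs]
      refine ⟨hro i ?_, ?_⟩ <;> rw [abs_le] <;> constructor <;> nlinarith
  · obtain ⟨j, ⟨_, hj⟩, h⟩ := hstep i
    exact ⟨j, hj, h⟩
  · -- the number of links is at most `2 / m`
    have hcount : n * (m / 2) ≤ 1 := by
      have himg : ∀ i ∈ Finset.range n, z i ∈ Finset.Icc (-k : ℤ) k := fun i hi => by
        have h1 := hnmin i (Finset.mem_range.1 hi)
        by_contra hc
        rw [Finset.mem_Icc] at hc
        have := hqk (z i) (by rw [lt_abs]; omega)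
        linarith
      calc n * (m / 2) = ∑ i ∈ Finset.range n, m / 2 := by simp
        _ ≤ ∑ i ∈ Finset.range n, o (z i) * q (z i) := by
            refine Finset.sum_le_sum fun i hi => ?_
            have h1 := hnmin i (Finset.mem_range.1 hi)
            have h2 : o (z i) ≠ 0 := fun h => by rw [hqo _ h] at h1; linarith
            have h3 : (1 : ℝ) ≤ o (z i) := by exact_mod_cast Nat.one_le_iff_ne_zero.2 h2
            nlinarith [hq0 (z i)]
        _ = ∑ y ∈ (Finset.range n).image z, o y * q y :=
            (Finset.sum_image (f := fun y => (o y : ℝ) * q y)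
              fun i _ j _ h => hmono.injective h).symm
        _ ≤ ∑ y ∈ Finset.Icc (-k : ℤ) k, o y * q y :=
            Finset.sum_le_sum_of_subset_of_nonneg (Finset.image_subset_iff.2 himg)
              fun y _ _ => mul_nonneg (Nat.cast_nonneg _) (hq0 y)
        _ = 1 := hmass
    have htel := Finset.sum_range_sub' (fun i => q (z i)) n
    have hcs := sq_sum_le_card_mul_sum_sq (s := Finset.range n)
      (f := fun i => q (z i) - q (z (i + 1)))
    rw [htel, Finset.card_range, hz0] at hcs
    set S := ∑ i ∈ Finset.range n, (q (z i) - q (z (i + 1))) ^ 2 with hS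
    have hS0 : 0 ≤ S := Finset.sum_nonneg fun _ _ => sq_nonneg _
    have h1 : (m / 2) ^ 2 ≤ n * S :=
      le_trans (pow_le_pow_left₀ (by positivity) (by linarith) 2) hcs
    have h2 : m ^ 3 / 8 ≤ S := by
      have h3 : n * (m / 2) * S ≤ 1 * S := mul_le_mul_of_nonneg_right hcount hS0
      have h4 : (m / 2) ^ 2 * (m / 2) ≤ n * S * (m / 2) :=
        mul_le_mul_of_nonneg_right h1 (by positivity)
      nlinarith
    have h5 := pow_le_pow_left₀ hE0 hEm 3
    linarith

/-- The event that at time `k` every stretch of `N` sites of one parity, near the range of the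
walk, holds a particle. -/
def wellSpread (k N : ℕ) : Set Config :=
  {c | ∀ y : ℤ, |y| ≤ (2 * N + 1) * k → ∃ i ∈ Finset.Icc 1 N, occ (envOf c) (k, y + 2 * i) ≠ 0}

lemma sum_occ_mul_share {c : Config} (h0 : 1 ≤ c.1 0) (k : ℕ) :
    ∑ y ∈ Finset.Icc (-k : ℤ) k, occ (envOf c) (k, y) * share (envOf c) k y = 1 := by
  rw [← sum_massAt (envOf c) k]
  refine Finset.sum_congr rfl fun y _ => ?_
  by_cases h : occ (envOf c) (k, y) = 0
  · simp [h, massAt_eq_zero_of_occ h0 k y h]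
  · have : (occ (envOf c) (k, y) : ℝ) ≠ 0 := by exact_mod_cast h
    rw [share]; field_simp

lemma sum_occ_mul_share_sq (ω : Env) (k : ℕ) :
    ∑ y ∈ Finset.Icc (-k : ℤ) k, occ ω (k, y) * share ω k y ^ 2 = energy ω k := by
  refine Finset.sum_congr rfl fun y _ => ?_
  by_cases h : occ ω (k, y) = 0
  · simp [h]
  · have : (occ ω (k, y) : ℝ) ≠ 0 := by exact_mod_cast h
    rw [share]; field_simp

lemma integrable_energy_resample {c : Config} (h0 : 1 ≤ c.1 0) (k j : ℕ) :
    Integrable (fun ξ' => energy (envOf (resample k c ξ')) j) coinLaw :=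
  Integrable.of_bound ((measurable_energy j).comp
    (measurable_envOf.comp (measurable_resample k c))).aestronglyMeasurable 1
    (ae_of_all _ fun ξ' => by
      rw [Real.norm_of_nonneg (energy_nonneg _ _)]
      exact energy_le_one (c := resample k c ξ') h0 j)

/-- Conditionally on a well spread configuration at time `k`, the links of the chain meet at time
`k + s` with probability at least `1 / (4 s)` each, which costs a definite amount of energy. -/
lemma integral_energy_resample_le {c : Config} (h0 : 1 ≤ c.1 0) {k N s : ℕ} (hN : 1 ≤ N)
    (hs : 8 * N ^ 2 ≤ s) (hc : c ∈ wellSpread k N) :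
    ∫ ξ', energy (envOf (resample k c ξ')) (k + s) ∂coinLaw ≤
      energy (envOf c) k - 1 / (128 * s ^ 2) * energy (envOf c) k ^ 3 := by
  have hs1 : 1 ≤ s := by nlinarith
  obtain ⟨n, z, hocc, hmono, hgap, hsum⟩ := exists_chain (q := share (envOf c) k)
    (o := fun y => occ (envOf c) (k, y)) hN (share_nonneg _ k) (fun y => share_eq_zero _)
    (fun y h => by rw [share, h]; simp) (sum_occ_mul_share h0 k) hc
  rw [sum_occ_mul_share_sq] at hsum
  set K : ℕ := (2 * N + 1) * k + 2 * N + 2 * (k + s) with hK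
  have hpart : ∀ i, ∃ p, i ≤ n → p ∈ particles c.1 K ∧ pos c p k = z i := fun i => by
    by_cases hi : i ≤ n
    · obtain ⟨h1, h2⟩ := hocc i hi
      rw [occ_envOf c (K := K) (by rw [hK]; push_cast; linarith), Finset.card_ne_zero] at h1
      obtain ⟨p, hp⟩ := h1
      exact ⟨p, fun _ => Finset.mem_filter.1 hp⟩
    · exact ⟨(0, 0), fun h => (hi h).elim⟩
  choose a ha using hpart
  have hinj : Set.InjOn a (Set.Iic n) := fun i hi j hj hij => by
    have h1 := (ha i hi).2
    rw [hij, (ha j hj).2] at h1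
    exact (hmono.injective h1).symm
  set Δ : ℕ → ℝ := fun i => (share (envOf c) k (z i) - share (envOf c) k (z (i + 1))) ^ 2 with hΔ
  have hshare : ∀ i ≤ n, shareOf c k (a i) = share (envOf c) k (z i) := fun i hi => by
    rw [shareOf, (ha i hi).2]
  set M : ℕ → Set (ℤ × ℕ → ℤ → Bool) := fun i =>
    {ξ' | pos (resample k c ξ') (a i) (k + s : ℕ) = pos (resample k c ξ') (a (i + 1)) (k + s : ℕ)}
    with hM
  have hMm : ∀ i, MeasurableSet (M i) := fun i => by
    have hp : ∀ p, Measurable fun ξ' => pos (resample k c ξ') p (k + s : ℕ) := fun p =>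
      (measurable_walk p _).comp (measurable_resample k c)
    exact measurableSet_eq_fun (hp _) (hp _)
  have hMprob : ∀ i < n, 1 / (4 * s : ℝ) ≤ coinLaw.real (M i) := fun i hi => by
    obtain ⟨j, hj, hz⟩ := hgap i
    have hne : a i ≠ a (i + 1) := fun h => by
      have := hinj (show i ∈ Set.Iic n from hi.le) (show i + 1 ∈ Set.Iic n from hi) h
      omega
    have h1 := coinLaw_meet_ge hne k hs1 (j := j) (by nlinarith)
    convert! h1 using 3
    ext ξ'
    rw [pos_resample_add, pos_resample_add, (ha i hi.le).2, (ha (i + 1) hi).2, hz]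
    constructor <;> intro h <;> linarith
  have hpt : ∀ ξ', ∑ i ∈ Finset.range n, (M i).indicator (fun _ => Δ i) ξ' ≤
      4 * s * (energy (envOf c) k - energy (envOf (resample k c ξ')) (k + s)) := fun ξ' => by
    have h1 := sum_sq_shareOf_sub_le (c := resample k c ξ') h0 k s (K := K) (n := n) (a := a)
      (by omega) (fun i hi => (ha i hi).1) hinj
    rw [energy_resample] at h1
    refine le_trans (le_of_eq (Finset.sum_congr rfl fun i hi => ?_)) h1
    rw [Finset.mem_range] at hi
    rw [Set.indicator_apply, shareOf_resample, shareOf_resample, hshare i hi.le,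
      hshare (i + 1) hi]
    rfl
  have hint := integral_mono (μ := coinLaw)
    (integrable_finsetSum _ fun i _ => (integrable_const (Δ i)).indicator (hMm i))
    (((integrable_const _).sub (integrable_energy_resample h0 k (k + s))).const_mul _) hpt
  rw [integral_finsetSum _ fun i _ => (integrable_const (Δ i)).indicator (hMm i),
    integral_const_mul,
    integral_sub' (integrable_const _) (integrable_energy_resample h0 k (k + s))]
    at hint
  simp only [integral_indicator_const _ (hMm _), smul_eq_mul, integral_const, probReal_univ,
    one_mul] at hint
  have hlow : 1 / (4 * s : ℝ) * (energy (envOf c) k ^ 3 / 8) ≤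
      ∑ i ∈ Finset.range n, coinLaw.real (M i) * Δ i := by
    refine (mul_le_mul_of_nonneg_left hsum (by positivity)).trans ?_
    rw [Finset.mul_sum]
    exact Finset.sum_le_sum fun i hi =>
      mul_le_mul_of_nonneg_right (hMprob i (Finset.mem_range.1 hi)) (sq_nonneg _)
  have hs0 : (0 : ℝ) < s := by exact_mod_cast hs1
  have h2 := hlow.trans hint
  set I := ∫ ξ', energy (envOf (resample k c ξ')) (k + s) ∂coinLaw
  have h3 : 1 / (4 * s : ℝ) * (1 / (4 * s : ℝ) * (energy (envOf c) k ^ 3 / 8)) ≤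
      1 / (4 * s : ℝ) * (4 * s * (energy (envOf c) k - I)) :=
    mul_le_mul_of_nonneg_left h2 (by positivity)
  have h4 : 1 / (4 * s : ℝ) * (4 * s * (energy (envOf c) k - I)) = energy (envOf c) k - I := by
    field_simp
  have h5 : 1 / (4 * s : ℝ) * (1 / (4 * s : ℝ) * (energy (envOf c) k ^ 3 / 8)) =
      1 / (128 * s ^ 2) * energy (envOf c) k ^ 3 := by field_simp; ring
  linarith

/-! ### Decay of the mean energy -/

lemma measurableSet_wellSpread (k N : ℕ) : MeasurableSet (wellSpread k N) := by
  have : wellSpread k N = ⋂ y : ℤ, {c | |y| ≤ (2 * N + 1) * k →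
      ∃ i ∈ Finset.Icc 1 N, occ (envOf c) (k, y + 2 * i) ≠ 0} := by
    ext c; simp [wellSpread]
  rw [this]
  refine MeasurableSet.iInter fun y => ?_
  by_cases hy : |y| ≤ (2 * N + 1) * (k : ℤ)
  · have : {c : Config | |y| ≤ (2 * N + 1) * (k : ℤ) →
        ∃ i ∈ Finset.Icc 1 N, occ (envOf c) (k, y + 2 * i) ≠ 0} =
        ⋃ i ∈ Finset.Icc 1 N, {c | occ (envOf c) (k, y + 2 * i) ≠ 0} := by
      ext c; simp [hy]
    rw [this]
    exact Finset.measurableSet_biUnion _ fun i _ =>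
      ((measurable_occ _).comp measurable_envOf) (MeasurableSet.singleton 0).compl
  · simp [hy]

lemma configLaw_compl_wellSpread_le (k N : ℕ) :
    configLaw.real (wellSpread k N)ᶜ ≤ (2 * ((2 * N + 1) * k) + 1) * Real.exp (-N) := by
  -- a union bound over the `2 R + 1` stretches
  set R : ℕ := (2 * N + 1) * k with hR
  set I : ℤ → Finset ℤ := fun y => (Finset.Icc 1 N).image fun i : ℕ => y + 2 * (i : ℤ) with hI
  have hIcard : ∀ y, (I y).card = N := fun y => by
    rw [hI, Finset.card_image_of_injective _ fun a b h => by simpa using h]; simp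
  have hsub : (wellSpread k N)ᶜ ⊆ ⋃ y ∈ Finset.Icc (-R : ℤ) R,
      {c : Config | ∀ p : ℤ × ℕ, p.2 < c.1 p.1 → walk p.1 (c.2 p) k ∉ I y} := by
    intro c hc
    simp only [wellSpread, Set.mem_compl_iff, Set.mem_ofPred_eq, not_forall, not_exists,
      not_and] at hc
    obtain ⟨y, hy, hno⟩ := hc
    simp only [Set.mem_iUnion]
    refine ⟨y, Finset.mem_Icc.2 (abs_le.1 (by rw [hR]; push_cast; exact hy)), fun p hp hw => ?_⟩
    obtain ⟨i, hi, hwi⟩ := Finset.mem_image.1 hw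
    refine hno i hi ?_
    rw [occ_envOf c (K := (y + 2 * i).natAbs + k) (by simp), Finset.card_ne_zero]
    refine ⟨p, Finset.mem_filter.2 ⟨mem_particles.2 ⟨?_, hp⟩, hwi.symm⟩⟩
    refine (abs_start_le c p k).trans ?_
    rw [show pos c p k = y + 2 * i from hwi.symm]
    simp
  have h1 := (measure_mono (μ := configLaw) hsub).trans (measure_biUnion_finset_le _ _)
  have h2 : ∑ y ∈ Finset.Icc (-R : ℤ) R,
      configLaw {c : Config | ∀ p : ℤ × ℕ, p.2 < c.1 p.1 → walk p.1 (c.2 p) k ∉ I y} ≤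
      ENNReal.ofReal ((2 * ((2 * N + 1) * k) + 1) * Real.exp (-N)) := by
    refine (Finset.sum_le_sum fun y _ => configLaw_empty_le (I y) k).trans (le_of_eq ?_)
    simp only [hIcard, Finset.sum_const, nsmul_eq_mul]
    rw [ENNReal.ofReal_mul (by positivity), ← ENNReal.ofReal_natCast]
    congr 2
    have : (Finset.Icc (-R : ℤ) R).card = 2 * R + 1 := by rw [Int.card_Icc]; omega
    rw [this, hR]
    push_cast
    ring
  exact ENNReal.toReal_le_of_le_ofReal (by positivity) (h1.trans h2)

/-- The expected energy at time `k` under the size-biased law. -/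
def meanEnergy (k : ℕ) : ℝ := ∫ c, energy (envOf c) k ∂biasedConfigLaw

lemma integrable_energy_pow (k j : ℕ) :
    Integrable (fun c => energy (envOf c) k ^ j) biasedConfigLaw :=
  Integrable.of_bound
    (((measurable_energy k).comp measurable_envOf).pow_const j).aestronglyMeasurable 1 (by
      filter_upwards [ae_biasedConfigLaw_occ_zero] with c hc
      rw [Real.norm_of_nonneg (pow_nonneg (energy_nonneg _ _) _)]
      exact pow_le_one₀ (energy_nonneg _ _) (energy_le_one hc k))

lemma integrable_energy (k : ℕ) : Integrable (fun c => energy (envOf c) k) biasedConfigLaw := by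
  simpa using integrable_energy_pow k 1

lemma meanEnergy_nonneg (k : ℕ) : 0 ≤ meanEnergy k :=
  integral_nonneg fun _ => energy_nonneg _ _

lemma meanEnergy_antitone : Antitone meanEnergy := fun j k hjk => by
  refine integral_mono_ae (integrable_energy k) (integrable_energy j) ?_
  filter_upwards [ae_biasedConfigLaw_occ_zero] with c hc
  exact energy_antitone hc hjk

lemma meanEnergy_le_one (k : ℕ) : meanEnergy k ≤ 1 := by
  have h : meanEnergy k ≤ ∫ _, 1 ∂biasedConfigLaw := by
    refine integral_mono_ae (integrable_energy k) (integrable_const _) ?_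
    filter_upwards [ae_biasedConfigLaw_occ_zero] with c hc
    exact energy_le_one hc k
  simpa using h

/-- Jensen's inequality for the cube, from the tangent line at the mean. -/
lemma meanEnergy_pow_three_le (k : ℕ) :
    meanEnergy k ^ 3 ≤ ∫ c, energy (envOf c) k ^ 3 ∂biasedConfigLaw := by
  set a := meanEnergy k with ha
  have h : ∫ c, (3 * a ^ 2 * energy (envOf c) k - 2 * a ^ 3) ∂biasedConfigLaw ≤
      ∫ c, energy (envOf c) k ^ 3 ∂biasedConfigLaw := by
    refine integral_mono (((integrable_energy k).const_mul _).sub (integrable_const _))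
      (integrable_energy_pow k 3) fun c => ?_
    have h1 := energy_nonneg (envOf c) k
    have h2 : 0 ≤ a := meanEnergy_nonneg k
    simp only
    -- `x ^ 3 - 3 * a ^ 2 * x + 2 * a ^ 3 = (x - a) ^ 2 * (x + 2 * a)`
    nlinarith [mul_nonneg (sq_nonneg (energy (envOf c) k - a))
      (add_nonneg h1 (mul_nonneg zero_le_two h2))]
  rw [integral_sub ((integrable_energy k).const_mul _) (integrable_const _), integral_const_mul]
    at h
  have e : ∫ c, energy (envOf c) k ∂biasedConfigLaw = a := rfl
  rw [e] at h
  simp only [integral_const, probReal_univ, smul_eq_mul, one_mul] at h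
  linarith [show 3 * a ^ 2 * a - 2 * a ^ 3 = a ^ 3 by ring]

lemma meanEnergy_add_le {k N s : ℕ} (hN : 1 ≤ N) (hs : 8 * N ^ 2 ≤ s) :
    meanEnergy (k + s) ≤ meanEnergy k - 1 / (128 * s ^ 2) *
      (meanEnergy k ^ 3 - (2 * ((2 * N + 1) * k) + 1) * Real.exp (-N)) := by
  set η : ℝ := 1 / (128 * s ^ 2) with hη
  have hη0 : 0 ≤ η := by positivity
  set B := (wellSpread k N)ᶜ with hB
  have hBm : MeasurableSet B := (measurableSet_wellSpread k N).compl
  set g : Config → ℝ := fun c => energy (envOf c) k ^ 3 with hg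
  have hgi : Integrable g biasedConfigLaw := integrable_energy_pow k 3
  have hbad : ∫ c, B.indicator g c ∂biasedConfigLaw ≤
      (2 * ((2 * N + 1) * k) + 1) * Real.exp (-N) := by
    refine (integral_indicator_biasedConfigLaw_le hBm (fun c hc => ?_)
      (fun c => pow_nonneg (energy_nonneg _ _) 3)
      (((measurable_energy k).comp measurable_envOf).pow_const 3)).trans
      (configLaw_compl_wellSpread_le k N)
    refine le_trans ?_ (energy_le hc k)
    have h1 := energy_nonneg (envOf c) k
    have h2 := energy_le_one hc k
    exact pow_le_of_le_one h1 h2 (by norm_num)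
  have hgd : Integrable (fun c => g c - B.indicator g c) biasedConfigLaw :=
    hgi.sub (hgi.indicator hBm)
  have hmain : meanEnergy (k + s) ≤
      ∫ c, (energy (envOf c) k - η * (g c - B.indicator g c)) ∂biasedConfigLaw := by
    rw [meanEnergy, ← integral_integral_resample k (integrable_energy (k + s))]
    have hint := integrable_integral_resample k (integrable_energy (k + s))
    refine integral_mono_ae hint ((integrable_energy k).sub (hgd.const_mul η)) ?_
    filter_upwards [ae_biasedConfigLaw_occ_zero] with c hc
    by_cases hw : c ∈ wellSpread k N
    · rw [Set.indicator_of_notMem (by simpa [hB] using hw), sub_zero]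
      exact integral_energy_resample_le hc hN hs hw
    · rw [Set.indicator_of_mem (by simpa [hB] using hw), sub_self, mul_zero, sub_zero]
      have h1 : ∀ ξ', energy (envOf (resample k c ξ')) (k + s) ≤ energy (envOf c) k := fun ξ' => by
        rw [← energy_resample k c ξ']
        exact energy_antitone (c := resample k c ξ') hc (by omega)
      have h2 := integral_mono (integrable_energy_resample hc k (k + s))
        (integrable_const (energy (envOf c) k)) h1
      rw [integral_const, probReal_univ, one_smul] at h2
      exact h2
  rw [integral_sub (integrable_energy k) (hgd.const_mul η),
    integral_const_mul, integral_sub hgi (hgi.indicator hBm)] at hmain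
  refine hmain.trans (sub_le_sub_left (mul_le_mul_of_nonneg_left ?_ hη0) _)
  exact sub_le_sub (meanEnergy_pow_three_le k) hbad

/-- The recursion `b ↦ b - η b ^ 3` decays like `(η j) ^ (-1/2)`, up to the accumulated error. -/
lemma le_of_cubic_recursion {b : ℕ → ℝ} {η ε : ℝ} {J : ℕ} (hη : 0 < η) (hη1 : η ≤ 1)
    (hε : 0 ≤ ε) (hb0 : ∀ j, 0 ≤ b j) (hb1 : ∀ j, b j ≤ 1)
    (hrec : ∀ j < J, b (j + 1) ≤ b j - η * (b j ^ 3 - ε)) :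
    ∀ j ≤ J, b j ≤ √(1 / (η * (j + 1))) + j * (η * ε) := by
  intro j
  induction j with
  | zero =>
    intro _
    have : (1 : ℝ) ≤ √(1 / (η * ((0 : ℕ) + 1))) := by
      rw [Real.one_le_sqrt, Nat.cast_zero, zero_add, mul_one]
      exact (one_le_div hη).2 hη1
    have := hb1 0
    push_cast at *
    linarith
  | succ j ih =>
    intro hj
    have h1 := ih (by omega)
    have h2 := hrec j (by omega)
    have hηε : 0 ≤ η * ε := by positivity
    -- `β` is `b j` without the error accumulated so far; it satisfies the recursion without error
    set β := b j - j * (η * ε) with hβ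
    have hβb : β ≤ b j := by rw [hβ]; nlinarith [mul_nonneg (Nat.cast_nonneg (α := ℝ) j) hηε]
    push_cast
    rcases le_or_gt β 0 with hneg | hpos
    · have := Real.sqrt_nonneg (1 / (η * ((j : ℝ) + 1 + 1)))
      have := mul_nonneg hη.le (pow_nonneg (hb0 j) 3)
      linarith
    · have hβsq : β ^ 2 ≤ 1 / (η * (j + 1)) := by
        have hle : β ≤ √(1 / (η * (j + 1))) := by linarith
        exact (Real.le_sqrt hpos.le (by positivity)).1 hle
      have hcube : β ^ 3 ≤ b j ^ 3 := pow_le_pow_left₀ hpos.le hβb 3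
      have hu : η * β ^ 2 * (j + 1) ≤ 1 := by
        rw [le_div_iff₀ (by positivity)] at hβsq
        linarith
      have hu0 : 0 ≤ η * β ^ 2 := by positivity
      have hj0 : (0 : ℝ) ≤ j := by positivity
      have hu1 : η * β ^ 2 ≤ 1 := by nlinarith
      have hstep : β * (1 - η * β ^ 2) ≤ √(1 / (η * (j + 1 + 1))) := by
        refine Real.le_sqrt_of_sq_le ?_
        rw [le_div_iff₀ (by positivity)]
        set u := η * β ^ 2 with hudef
        have e : (β * (1 - u)) ^ 2 * (η * (j + 1 + 1)) = u * (1 - u) ^ 2 * (j + 1 + 1) := by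
          rw [hudef]; ring
        rw [e]
        -- if `u * (j + 1) ≤ 1`, then `u * (1 - u) * (j + 2) ≤ 1`
        have h3 : u * (1 - u) ^ 2 * (j + 1 + 1) ≤ u * (1 - u) * (j + 1 + 1) := by
          refine mul_le_mul_of_nonneg_right ?_ (by positivity)
          nlinarith [mul_nonneg hu0 (sub_nonneg.2 hu1),
            mul_nonneg (mul_nonneg hu0 hu0) (sub_nonneg.2 hu1)]
        nlinarith [mul_nonneg (sub_nonneg.2 hu) (sub_nonneg.2 hu1)]
      have := mul_le_mul_of_nonneg_left hcube hη.le
      linarith [show β * (1 - η * β ^ 2) = β - η * β ^ 3 by ring]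

lemma sum_one_div_sqrt_le (n : ℕ) :
    ∑ k ∈ Finset.range n, √(1 / ((k : ℝ) + 1)) ≤ 2 * √n := by
  induction n with
  | zero => simp
  | succ n ih =>
    rw [Finset.sum_range_succ]
    have hx := Real.sqrt_nonneg (n : ℝ)
    have hx2 := Real.sq_sqrt (Nat.cast_nonneg (α := ℝ) n)
    have hy : 0 < √((n : ℝ) + 1) := Real.sqrt_pos.2 (by positivity)
    have hy2 := Real.sq_sqrt (show (0 : ℝ) ≤ n + 1 by positivity)
    have h1 : √(1 / ((n : ℝ) + 1)) = 1 / √((n : ℝ) + 1) := by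
      rw [Real.sqrt_div zero_le_one, Real.sqrt_one]
    push_cast
    rw [h1]
    have h2 : 1 / √((n : ℝ) + 1) ≤ 2 * √((n : ℝ) + 1) - 2 * √n := by
      rw [div_le_iff₀ hy]
      nlinarith [sq_nonneg (√((n : ℝ) + 1) - √n)]
    linarith

lemma sum_meanEnergy_le {N n : ℕ} (hN : 1 ≤ N) :
    ∑ k ∈ Finset.range n, meanEnergy k ≤
      512 * N ^ 3 * √n + n ^ 2 * ((2 * ((2 * N + 1) * n) + 1) * Real.exp (-N)) := by
  set s : ℕ := 8 * N ^ 2 with hs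
  have hs1 : 1 ≤ s := by nlinarith
  have hs1' : (1 : ℝ) ≤ s := by exact_mod_cast hs1
  set η : ℝ := 1 / (128 * s ^ 2) with hη
  have hη0 : 0 < η := by positivity
  have hη1 : η ≤ 1 := by
    rw [hη, div_le_one (by positivity)]
    nlinarith
  set ε : ℝ := (2 * ((2 * N + 1) * n) + 1) * Real.exp (-N) with hε
  have hε0 : 0 ≤ ε := by positivity
  have hrec := le_of_cubic_recursion (b := fun j => meanEnergy (j * s)) (J := n / s) hη0 hη1 hε0
    (fun j => meanEnergy_nonneg _) (fun j => meanEnergy_le_one _) fun j hj => by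
      have h1 := meanEnergy_add_le (k := j * s) hN hs.ge
      rw [show j * s + s = (j + 1) * s by ring] at h1
      refine h1.trans (sub_le_sub_left (mul_le_mul_of_nonneg_left ?_ hη0.le) _)
      refine sub_le_sub_left ?_ _
      have h2 : ((j * s : ℕ) : ℝ) ≤ n := by
        exact_mod_cast (Nat.mul_le_mul_right s hj.le).trans (Nat.div_mul_le_self n s)
      rw [hε]
      gcongr
  have hterm : ∀ k ∈ Finset.range n,
      meanEnergy k ≤ 256 * N ^ 3 * √(1 / ((k : ℝ) + 1)) + n * ε := by
    intro k hk
    rw [Finset.mem_range] at hk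
    have h1 : meanEnergy k ≤ meanEnergy (k / s * s) :=
      meanEnergy_antitone (Nat.div_mul_le_self k s)
    have h2 := hrec (k / s) (Nat.div_le_div_right hk.le)
    have h3 : ((k / s : ℕ) : ℝ) * (η * ε) ≤ n * ε := by
      have h4 : ((k / s : ℕ) : ℝ) ≤ n := by exact_mod_cast (Nat.div_le_self k s).trans hk.le
      have h5 : η * ε ≤ ε := mul_le_of_le_one_left hε0 hη1
      gcongr
    have h4 : √(1 / (η * ((k / s : ℕ) + 1))) ≤ 256 * N ^ 3 * √(1 / ((k : ℝ) + 1)) := by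
      have h5 : (k : ℝ) + 1 ≤ s * ((k / s : ℕ) + 1) := by
        exact_mod_cast Nat.lt_mul_div_succ k hs1
      -- `√(s / η) = √(128 s ^ 3) = 256 N ^ 3`
      have h6 : 1 / (η * ((k / s : ℕ) + 1)) ≤ (256 * (N : ℝ) ^ 3) ^ 2 * (1 / ((k : ℝ) + 1)) := by
        have h7 : (256 * (N : ℝ) ^ 3) ^ 2 * η = s := by
          rw [hη, hs]; push_cast; field_simp; ring
        rw [mul_one_div, div_le_div_iff₀ (by positivity) (by positivity), one_mul, ← mul_assoc, h7]
        exact h5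
      refine (Real.sqrt_le_sqrt h6).trans (le_of_eq ?_)
      rw [Real.sqrt_mul (by positivity), Real.sqrt_sq (by positivity)]
    linarith
  refine (Finset.sum_le_sum hterm).trans ?_
  rw [Finset.sum_add_distrib, ← Finset.mul_sum, Finset.sum_const, Finset.card_range, nsmul_eq_mul]
  have h1 := mul_le_mul_of_nonneg_left (sum_one_div_sqrt_le n)
    (show (0 : ℝ) ≤ 256 * N ^ 3 by positivity)
  linarith [show (n : ℝ) ^ 2 * ε = n * (n * ε) by ring]

/-! ### The variance of the quenched mean -/

lemma abs_quenchedDrift_le (ω : Env) (n : ℕ) : |quenchedDrift ω n| ≤ n := by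
  refine (Finset.abs_sum_le_sum_abs _ _).trans ?_
  have h : ∀ y ∈ Finset.Icc (-n : ℤ) n,
      |massAt ω n y * (y : ℝ)| ≤ massAt ω n y * n := fun y hy => by
    rw [abs_mul, abs_of_nonneg (massAt_nonneg ω n y)]
    refine mul_le_mul_of_nonneg_left ?_ (massAt_nonneg ω n y)
    rw [Finset.mem_Icc] at hy
    rw [abs_le]
    exact ⟨by exact_mod_cast hy.1, by exact_mod_cast hy.2⟩
  refine (Finset.sum_le_sum h).trans ?_
  rw [← Finset.sum_mul, sum_massAt, one_mul]

lemma quenchedDrift_sq_le (ω : Env) (n : ℕ) : ‖quenchedDrift ω n ^ 2‖ ≤ (n : ℝ) ^ 2 := by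
  rw [norm_pow, Real.norm_eq_abs]
  exact pow_le_pow_left₀ (abs_nonneg _) (abs_quenchedDrift_le ω n) 2

lemma integrable_quenchedDrift_sq (n : ℕ) :
    Integrable (fun c => quenchedDrift (envOf c) n ^ 2) biasedConfigLaw :=
  Integrable.of_bound
    (((measurable_quenchedDrift n).comp measurable_envOf).pow_const 2).aestronglyMeasurable _
    (ae_of_all _ fun c => quenchedDrift_sq_le (envOf c) n)

lemma integral_quenchedDrift_sq (n : ℕ) :
    ∫ c, quenchedDrift (envOf c) n ^ 2 ∂biasedConfigLaw = ∑ k ∈ Finset.range n, meanEnergy k := by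
  induction n with
  | zero => simp [quenchedDrift]
  | succ n ih =>
    rw [Finset.sum_range_succ, ← ih, meanEnergy,
      ← integral_integral_resample n (integrable_quenchedDrift_sq (n + 1)),
      ← integral_add (integrable_quenchedDrift_sq n) (integrable_energy n)]
    refine integral_congr_ae ?_
    filter_upwards [ae_biasedConfigLaw_occ_zero] with c hc
    exact integral_quenchedDrift_succ_sq hc n

lemma tiltedLaw_eq : tiltedLaw = biasedConfigLaw.map envOf := by
  have hm : Measurable fun ω : Env => (occ ω (0, 0) : ℝ≥0∞) :=
    (measurable_of_countable fun n : ℕ => (n : ℝ≥0∞)).comp (measurable_occ _)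
  refine Measure.ext_of_lintegral _ fun f hf => ?_
  rw [tiltedLaw, envLaw, lintegral_withDensity_eq_lintegral_mul _ hm hf,
    lintegral_map (hm.mul hf) measurable_envOf, lintegral_map hf measurable_envOf,
    biasedConfigLaw, lintegral_withDensity_eq_lintegral_mul _ measurable_config_occ_zero
      (g := fun c => f (envOf c)) (hf.comp measurable_envOf)]
  simp [occ_envOf_zero]

instance : IsProbabilityMeasure tiltedLaw := by
  rw [tiltedLaw_eq]
  exact Measure.isProbabilityMeasure_map measurable_envOf.aemeasurable

lemma integral_quenchedDrift_sq_tiltedLaw (n : ℕ) :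
    ∫ ω, quenchedDrift ω n ^ 2 ∂tiltedLaw = ∑ k ∈ Finset.range n, meanEnergy k := by
  rw [tiltedLaw_eq, integral_map measurable_envOf.aemeasurable
    ((measurable_quenchedDrift n).pow_const 2).aestronglyMeasurable, integral_quenchedDrift_sq]

/-- The choice `N = ⌈8 log n⌉` makes the contribution of badly spread configurations bounded. -/
lemma sum_meanEnergy_le_log {n : ℕ} (hn : 3 ≤ n) :
    ∑ k ∈ Finset.range n, meanEnergy k ≤ 400000 * (√n * Real.log n ^ 3) := by
  have hn3 : (3 : ℝ) ≤ n := by exact_mod_cast hn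
  have hn0 : (0 : ℝ) < n := by linarith
  have hlog : 1 ≤ Real.log n := by
    rw [Real.le_log_iff_exp_le hn0]
    linarith [Real.exp_one_lt_d9]
  set N : ℕ := ⌈8 * Real.log n⌉₊ with hNdef
  have hNge : 8 * Real.log n ≤ N := Nat.le_ceil _
  have hNle : (N : ℝ) ≤ 9 * Real.log n := by
    have := Nat.ceil_lt_add_one (show 0 ≤ 8 * Real.log n by linarith)
    linarith
  have hN1' : (1 : ℝ) ≤ N := by linarith
  have hN1 : 1 ≤ N := by exact_mod_cast hN1'
  have hsqrt : 1 ≤ √(n : ℝ) := Real.one_le_sqrt.2 (by linarith)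
  have hexp : (N : ℝ) * Real.exp (-N) * n ^ 4 ≤ 2 := by
    have h1 : (N : ℝ) ≤ 2 * Real.exp (N / 2) := by
      have := Real.add_one_le_exp ((N : ℝ) / 2)
      linarith
    have h2 : (n : ℝ) ^ 4 ≤ Real.exp (N / 2) := by
      rw [← Real.exp_log (pow_pos hn0 4), Real.log_pow]
      exact Real.exp_le_exp.2 (by push_cast; linarith)
    calc (N : ℝ) * Real.exp (-N) * n ^ 4
        ≤ (2 * Real.exp (N / 2)) * Real.exp (-N) * Real.exp (N / 2) := by gcongr
      _ = 2 * Real.exp (N / 2 + -N + N / 2) := by rw [Real.exp_add, Real.exp_add]; ring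
      _ = 2 := by rw [show (N : ℝ) / 2 + -N + N / 2 = 0 by ring, Real.exp_zero, mul_one]
  have herr : (n : ℝ) ^ 2 * ((2 * ((2 * N + 1) * n) + 1) * Real.exp (-N)) ≤ 14 := by
    have h1 : (2 * ((2 * N + 1) * n) + 1 : ℝ) ≤ 7 * N * n ^ 2 := by
      nlinarith [mul_le_mul hN1' hn3 (by norm_num) (by positivity)]
    calc (n : ℝ) ^ 2 * ((2 * ((2 * N + 1) * n) + 1) * Real.exp (-N))
        ≤ n ^ 2 * (7 * N * n ^ 2 * Real.exp (-N)) := by gcongr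
      _ = 7 * (N * Real.exp (-N) * n ^ 4) := by ring
      _ ≤ 14 := by linarith
  have hlog3 : 1 ≤ Real.log n ^ 3 := one_le_pow₀ hlog
  have hprod : 1 ≤ √(n : ℝ) * Real.log n ^ 3 := one_le_mul_of_one_le_of_one_le hsqrt hlog3
  have hN3 : (N : ℝ) ^ 3 ≤ 729 * Real.log n ^ 3 := by
    calc (N : ℝ) ^ 3 ≤ (9 * Real.log n) ^ 3 := by gcongr
      _ = 729 * Real.log n ^ 3 := by ring
  have hmain : 512 * (N : ℝ) ^ 3 * √n ≤ 373248 * (√n * Real.log n ^ 3) := by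
    calc 512 * (N : ℝ) ^ 3 * √n ≤ 512 * (729 * Real.log n ^ 3) * √n := by gcongr
      _ = _ := by ring
  linarith [sum_meanEnergy_le (n := n) hN1]

end MassSplitting

end

theorem mainTheorem3 :
    (∀ᵐ ω ∂MassSplitting.tiltedLaw, ∀ n : ℕ,
      Integrable (fun X : ℕ → ℤ × ℤ => MassSplitting.toPlane (X n))
        (MassSplitting.quenchedLaw ω (0, 0))) ∧
    (∀ n : ℕ, Integrable
      (fun ω => ‖MassSplitting.quenchedMean ω n - MassSplitting.toPlane (n, 0)‖ ^ 2)
      MassSplitting.tiltedLaw) ∧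
    (fun n : ℕ => ∫ ω, ‖MassSplitting.quenchedMean ω n - MassSplitting.toPlane (n, 0)‖ ^ 2
      ∂MassSplitting.tiltedLaw) =O[atTop] fun n : ℕ => √(n : ℝ) * Real.log n ^ 3 := by
  refine ⟨ae_of_all _ fun ω n => MassSplitting.integrable_toPlane ω n, fun n => ?_, ?_⟩
  · simp only [MassSplitting.norm_quenchedMean_sub_sq]
    exact Integrable.of_bound
      ((MassSplitting.measurable_quenchedDrift n).pow_const 2).aestronglyMeasurable _
      (ae_of_all _ fun ω => MassSplitting.quenchedDrift_sq_le ω n)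
  · simp only [MassSplitting.norm_quenchedMean_sub_sq,
      MassSplitting.integral_quenchedDrift_sq_tiltedLaw]
    refine IsBigO.of_bound 400000 ?_
    filter_upwards [eventually_ge_atTop 3] with n hn
    rw [Real.norm_of_nonneg (Finset.sum_nonneg fun k _ => MassSplitting.meanEnergy_nonneg k)]
    exact (MassSplitting.sum_meanEnergy_le_log hn).trans
      (mul_le_mul_of_nonneg_left (le_abs_self _) (by norm_num))
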